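/- \textbf{Conventions.} A \emph{represented space} $\mathbf X=(X,\delta_{\mathbf X})$ is a set $X$ with a partial surjection $\delta_{\mathbf X}:\subseteq\mathbb N^{\mathbb N}\to X$, called a representation of $X$; $p$ is a \emph{name} of $\delta_{\mathbf X}(p)$. A function $f:\mathbf X\to\mathbf Y$ is \emph{computable} (\emph{continuous}) if some computable (continuous) partial function $F$ on $\mathbb N^{\mathbb N}$ satisfies $\delta_{\mathbf Y}(F(p))=f(\delta_{\mathbf X}(p))$ for all $p\in\mathrm{dom}(\delta_{\mathbf X})$. The space $\mathcal C(\mathbf X,\mathbf Y)$ of continuous functions is represented by codes of continuous realizers. The space $\mathbb N^{\mathbb N}$ is represented by the identity and $\mathbb N$ by $p\mapsto p(0)$. A subset of a represented space carries the restricted representation. A computable isomorphism is a bijection that is computable in both directions. Sierpiński space $\Sigma=\{\bot,\top\}$ is represented by the total map for which $0^\omega$ is the only name of $\bot$, and $\mathcal O(\mathbf X)=\mathcal C(\mathbf X,\Sigma)$ is the space of open subsets of $\mathbf X$. The elements of $\mathcal O(\mathbb N)$ are all subsets of $\mathbb N$, represented by their enumerations. The space $\mathcal V(\mathbf X)$ is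 the subspace of $\mathcal O(\mathcal O(\mathbf X))$ of those elements whose characteristic functions preserve finite joins; a set $A\subseteq X$ determines the element $\{U\in\mathcal O(\mathbf X)\mid U\cap A\neq\emptyset\}$ of $\mathcal V(\mathbf X)$. A set $S\subseteq X$ is $\Pi^0_2$ if there are computable sequences $(U_n)_{n\in\mathbb N}$, $(V_n)_{n\in\mathbb N}$ in $\mathcal O(\mathbf X)$ with $S=\{x\mid\forall n\,(x\in U_n\Rightarrow x\in V_n)\}$. A representation $\delta$ of the set $X$ is \emph{a representation of the space $\mathbf X$} if the identity is a computable isomorphism between $(X,\delta)$ and $\mathbf X$. It is \emph{effectively fiber-overt} if $x\mapsto\overline{\delta^{-1}(\{x\})}:(X,\delta)\to\mathcal V(\mathbb N^{\mathbb N})$ is computable. It is \emph{computably admissible} if $x\mapsto\{U\in\mathcal O(X,\delta)\mid x\in U\}$ is a computable isomorphism from $(X,\delta)$ onto its range, a subspace of $\mathcal O(\mathcal O(X,\delta))$. Let $\prec$ be a binary relation on $\mathbb N$. A \emph{rounded ideal} of $\prec$ is a non-empty set $I\subseteq\mathbb N$ such that $y\in I$ and $x\prec y$ imply $x\in I$,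 and such that for all $x,y\in I$ there is $z\in I$ with $x\prec z$ and $y\prec z$. Let $\mathrm{RI}(\prec)$ be the subspace of $\mathcal O(\mathbb N)$ that consists of the rounded ideals of $\prec$. \textbf{Theorem.} For every represented space $\mathbf X$ the following are equivalent: \begin{enumerate} \item[(i)] there is a computably enumerable transitive relation $\prec\ \subseteq\mathbb N\times\mathbb N$ such that $\mathbf X$ is computably isomorphic to $\mathrm{RI}(\prec)$; \item[(ii)] $\mathbf X$ is computably isomorphic to a $\Pi^0_2$ subspace of $\mathcal O(\mathbb N)$; \item[(iii)] $\mathbf X$ has an effectively fiber-overt and computably admissible representation $\delta$ whose domain $\mathrm{dom}(\delta)\subseteq\mathbb N^{\mathbb N}$ is $\Pi^0_2$. \end{enumerate} -/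

import Mathlib

universe u v

namespace RepSpace

/-- Baire space. Mathlib's product topology (with `ℕ` discrete) is the usual one. -/
abbrev Baire : Type := ℕ → ℕ

/-- The first `k` entries of `p`. -/
def prefixOf (p : Baire) (k : ℕ) : List ℕ := (List.range k).map p

/-- The query "what is the `n`-th output symbol, having read `k` symbols of the input `p`?". -/
def query (n : ℕ) (p : Baire) (k : ℕ) : ℕ := Encodable.encode (n, prefixOf p k)

/-- Kleene application: `q`, read as a code of a partial continuous function on Baire space, is
defined at `p` with value `r`. The `n`-th entry of the value is determined by the least `k` for
which the answer of `q` to `query n p k` is nonzero (the answer `0` means "read on", the answer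
`v + 1` means "the output symbol is `v`"). The partial functions with a computable code `q` are
(up to extension of their domains) exactly the computable ones. -/
def App (q p r : Baire) : Prop :=
  ∀ n, ∃ k, q (query n p k) = r n + 1 ∧ ∀ j < k, q (query n p j) = 0

theorem App.unique {q p r s : Baire} (hr : App q p r) (hs : App q p s) : r = s := by
  funext n
  obtain ⟨k, hk, hk'⟩ := hr n
  obtain ⟨l, hl, hl'⟩ := hs n
  rcases lt_trichotomy k l with h | h | h
  · have := hl' k h
    omega
  · subst h
    omega
  · have := hk' l h
    omega

/-- A representation of the set `X`: a partial surjection from Baire space onto `X`, given by its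
graph (`IsName p x` says that `p` is in the domain and is mapped to `x`). A represented space is
a set together with a representation. -/
structure Representation (X : Type u) where
  IsName : Baire → X → Prop
  unique : ∀ {p x y}, IsName p x → IsName p y → x = y
  surj : ∀ x, ∃ p, IsName p x

/-- The domain of a representation. -/
def Representation.dom {X : Type u} (δ : Representation X) : Set Baire := {p | ∃ x, δ.IsName p x}

/-- The restriction of a representation to a subset, with the same names. -/
def Representation.subspace {X : Type u} (δ : Representation X) (S : Set X) :
    Representation S where
  IsName p x := δ.IsName p x
  unique h h' := Subtype.ext (δ.unique h h')
  surj x := δ.surj x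

/-- The partial function with code `q` is a realizer of `f`. -/
def Realizes {X : Type u} {Y : Type v} (δ : Representation X) (γ : Representation Y)
    (q : Baire) (f : X → Y) : Prop :=
  ∀ p x, δ.IsName p x → ∃ r, App q p r ∧ γ.IsName r (f x)

/-- `f` is computable: it has a computable realizer. -/
def IsComputable {X : Type u} {Y : Type v} (δ : Representation X) (γ : Representation Y)
    (f : X → Y) : Prop :=
  ∃ q : Baire, Computable q ∧ Realizes δ γ q f

/-- Two represented spaces are computably isomorphic. -/
def ComputablyIsomorphic {X : Type u} {Y : Type v} (δ : Representation X)
    (γ : Representation Y) : Prop :=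
  ∃ e : X ≃ Y, IsComputable δ γ e ∧ IsComputable γ δ e.symm

/-- Two representations of the same set are computably equivalent, i.e. they are representations
of the same represented space up to the identity. -/
def ComputablyEquivalent {X : Type u} (δ γ : Representation X) : Prop :=
  IsComputable δ γ (fun x => x) ∧ IsComputable γ δ (fun x => x)

/-- `f` is a computable isomorphism onto its range, a subspace of the codomain. -/
def IsComputableEmbedding {X : Type u} {Y : Type v} (δ : Representation X)
    (γ : Representation Y) (f : X → Y) : Prop :=
  ∃ e : X ≃ Set.range f, (∀ x, (e x : Y) = f x) ∧
    IsComputable δ (γ.subspace (Set.range f)) e ∧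
    IsComputable (γ.subspace (Set.range f)) δ e.symm

/-- Baire space, represented by the identity. -/
def baire : Representation Baire where
  IsName p x := p = x
  unique h h' := h.symm.trans h'
  surj x := ⟨x, rfl⟩

/-- The natural numbers: `p` is a name of `p 0`. -/
def nat : Representation ℕ where
  IsName p n := p 0 = n
  unique h h' := h.symm.trans h'
  surj n := ⟨fun _ => n, rfl⟩

/-- Sierpiński space, on the set of truth values: the zero sequence is the only name of `False`,
and all other sequences are names of `True`. -/
def sierpinski : Representation Prop where
  IsName p s := s ↔ ∃ n, p n ≠ 0
  unique h h' := propext (h.trans h'.symm)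
  surj s := by
    by_cases hs : s
    · exact ⟨fun _ => 1, by simp [hs]⟩
    · exact ⟨fun _ => 0, by simp [hs]⟩

/-- The continuous functions between represented spaces: those with a continuous realizer. -/
def ContMap {X : Type u} {Y : Type v} (δ : Representation X) (γ : Representation Y) :
    Type (max u v) :=
  {f : X → Y // ∃ q, Realizes δ γ q f}

/-- The function space: the names of `f` are the codes of its continuous realizers. -/
def funSpace {X : Type u} {Y : Type v} (δ : Representation X) (γ : Representation Y) :
    Representation (ContMap δ γ) where
  IsName q f := Realizes δ γ q f.1
  unique {q f g} hf hg := by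
    apply Subtype.ext
    funext x
    obtain ⟨p, hp⟩ := δ.surj x
    obtain ⟨r, hr, hr'⟩ := hf p x hp
    obtain ⟨s, hs, hs'⟩ := hg p x hp
    obtain rfl := hr.unique hs
    exact γ.unique hr' hs'
  surj f := f.2

/-- The open subsets of a represented space, identified with their continuous characteristic
functions into Sierpiński space. -/
abbrev OpenSet {X : Type u} (δ : Representation X) : Type u := ContMap δ sierpinski

/-- The space of open subsets of a represented space. -/
def openSpace {X : Type u} (δ : Representation X) : Representation (OpenSet δ) :=
  funSpace δ sierpinski

instance {X : Type u} (δ : Representation X) : Membership X (OpenSet δ) where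
  mem U x := U.1 x

/-- For every set `A` of points, the open sets that meet `A` form an open subset of the space of
open sets. -/
theorem exists_realizes_hit {X : Type u} (δ : Representation X) (A : Set X) :
    ∃ q, Realizes (openSpace δ) sierpinski q (fun U : OpenSet δ => ∃ x ∈ A, x ∈ U) := by
  classical
  let W : List ℕ → Prop := fun w => ∃ p x m k v, x ∈ A ∧ δ.IsName p x ∧
    w[query m p k]? = some (v + 2) ∧ ∀ j < k, w[query m p j]? = some 0
  let d : ℕ → ℕ × List ℕ := fun c => (Encodable.decode c).getD (0, [])
  refine ⟨fun c => if (d c).2.length = (d c).1 then (if W (d c).2 then 2 else 1) else 0, ?_⟩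
  intro q U hq
  refine ⟨fun n => if W (prefixOf q n) then 1 else 0, ?_, ?_⟩
  · intro n
    refine ⟨n, ?_, ?_⟩
    · by_cases h : W (prefixOf q n) <;> simp [d, query, h]
      · simp [prefixOf]
      · simp [prefixOf]
    · intro j hj
      simp [d, query, prefixOf, hj.ne]
  · have key : ∀ n i a, (prefixOf q n)[i]? = some a → q i = a := by
      intro n i a h
      simp only [prefixOf, List.getElem?_map, Option.map_eq_some_iff,
        List.getElem?_eq_some_iff] at h
      obtain ⟨_, ⟨_, hb⟩, rfl⟩ := h
      rw [← hb]
      simp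
    have key' : ∀ n i, i < n → (prefixOf q n)[i]? = some (q i) := by
      intro n i h
      simp [prefixOf, h]
    constructor
    · rintro ⟨x, hxA, hxU⟩
      obtain ⟨p, hp⟩ := δ.surj x
      obtain ⟨r, hr, hr'⟩ := hq p x hp
      obtain ⟨m, hm⟩ := hr'.1 hxU
      obtain ⟨k, hk, hk'⟩ := hr m
      obtain ⟨n, hn⟩ : ∃ n, ∀ j ≤ k, query m p j < n := by
        refine ⟨(Finset.range (k + 1)).sup (query m p) + 1, fun j hj => ?_⟩
        exact Nat.lt_succ_of_le (Finset.le_sup (f := query m p) (Finset.mem_range.2 (by omega)))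
      refine ⟨n, ?_⟩
      have : W (prefixOf q n) := by
        refine ⟨p, x, m, k, r m - 1, hxA, hp, ?_, ?_⟩
        · rw [key' _ _ (hn k le_rfl), hk]
          congr 1
          omega
        · intro j hj
          rw [key' _ _ (hn j hj.le), hk' j hj]
      simp [this]
    · rintro ⟨n, hn⟩
      have hW : W (prefixOf q n) := by
        by_contra h
        simp [h] at hn
      obtain ⟨p, x, m, k, v, hxA, hp, hk, hk'⟩ := hW
      refine ⟨x, hxA, ?_⟩
      obtain ⟨r, hr, hr'⟩ := hq p x hp
      refine hr'.2 ⟨m, ?_⟩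
      obtain ⟨l, hl, hl'⟩ := hr m
      have h1 := key _ _ _ hk
      rcases lt_trichotomy k l with h | h | h
      · have := hl' k h
        omega
      · subst h
        omega
      · have := key _ _ _ (hk' l h)
        omega

/-- The set of all open `U` that meet `A`, as a point of the space of open sets of open sets. -/
def hit {X : Type u} (δ : Representation X) (A : Set X) : OpenSet (openSpace δ) :=
  ⟨fun U : OpenSet δ => ∃ x ∈ A, x ∈ U, exists_realizes_hit δ A⟩

/-- `𝒰` preserves finite joins: it omits the empty set, and it has a union of two open sets as a
member iff it has one of the two as a member. -/
def PreservesJoins {X : Type u} {δ : Representation X} (𝒰 : OpenSet (openSpace δ)) : Prop :=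
  (∀ U : OpenSet δ, (∀ x, x ∉ U) → U ∉ 𝒰) ∧
  ∀ U V W : OpenSet δ, (∀ x, x ∈ W ↔ x ∈ U ∨ x ∈ V) → (W ∈ 𝒰 ↔ U ∈ 𝒰 ∨ V ∈ 𝒰)

theorem preservesJoins_hit {X : Type u} (δ : Representation X) (A : Set X) :
    PreservesJoins (hit δ A) := by
  refine ⟨fun U hU ⟨x, _, hx⟩ => hU x hx, fun U V W h => ⟨?_, ?_⟩⟩
  · rintro ⟨x, hA, hx⟩
    rcases (h x).1 hx with h | h
    · exact Or.inl ⟨x, hA, h⟩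
    · exact Or.inr ⟨x, hA, h⟩
  · rintro (⟨x, hA, hx⟩ | ⟨x, hA, hx⟩)
    · exact ⟨x, hA, (h x).2 (Or.inl hx)⟩
    · exact ⟨x, hA, (h x).2 (Or.inr hx)⟩

/-- The space of overt subsets: the subspace of join preserving points of the space of open sets
of open sets. -/
def overtSpace {X : Type u} (δ : Representation X) :
    Representation {𝒰 : OpenSet (openSpace δ) | PreservesJoins 𝒰} :=
  (openSpace (openSpace δ)).subspace _

/-- The overt set determined by the set `A` of points, i.e. the open sets that meet `A`. -/
def overt {X : Type u} (δ : Representation X) (A : Set X) :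
    {𝒰 : OpenSet (openSpace δ) | PreservesJoins 𝒰} :=
  ⟨hit δ A, preservesJoins_hit δ A⟩

/-- The map from a point to the open set of its open neighbourhoods. -/
def nbhds {X : Type u} (δ : Representation X) (x : X) : OpenSet (openSpace δ) :=
  ⟨fun U : OpenSet δ => x ∈ U, by
    simpa using exists_realizes_hit δ {x}⟩

/-- A representation is computably admissible if the map from points to their neighbourhood
filters is a computable embedding. -/
def ComputablyAdmissible {X : Type u} (δ : Representation X) : Prop :=
  IsComputableEmbedding δ (openSpace (openSpace δ)) (nbhds δ)

/-- A representation is effectively fiber-overt if the closure of the fiber of a point is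
computable from the point, as an overt subset of Baire space. -/
def EffectivelyFiberOvert {X : Type u} (δ : Representation X) : Prop :=
  IsComputable δ (overtSpace baire) (fun x => overt baire (closure {p | δ.IsName p x}))

/-- The (lightface) `Π⁰₂` subsets of a represented space: there are computable sequences `U`, `V`
of open sets such that `S` is the set of all points that lie in `V n` whenever they lie
in `U n`. -/
def IsPi02 {X : Type u} (δ : Representation X) (S : Set X) : Prop :=
  ∃ U V : ℕ → OpenSet δ, IsComputable nat (openSpace δ) U ∧ IsComputable nat (openSpace δ) V ∧
    ∀ x, x ∈ S ↔ ∀ n, x ∈ U n → x ∈ V n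

/-- The space of all (open) subsets of `ℕ`, represented by enumerations: `p` is a name of `A` iff
`A` consists of all `n` for which `n + 1` is a value of `p`. The value `0` lists nothing. -/
def openNat : Representation (Set ℕ) where
  IsName p A := A = {n | ∃ i, p i = n + 1}
  unique h h' := h.trans h'.symm
  surj A := by
    classical
    refine ⟨fun i => if i ∈ A then i + 1 else 0, ?_⟩
    ext n
    constructor
    · intro h
      exact ⟨n, by simp [h]⟩
    · rintro ⟨i, hi⟩
      by_cases h : i ∈ A
      · have : i = n := by simpa [h] using hi
        exact this ▸ h
      · simp [h] at hi

/-- Rounded ideals of a binary relation on `ℕ`. -/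
structure IsRoundedIdeal (r : ℕ → ℕ → Prop) (I : Set ℕ) : Prop where
  nonempty : I.Nonempty
  lower : ∀ x y, y ∈ I → r x y → x ∈ I
  directed : ∀ x y, x ∈ I → y ∈ I → ∃ z ∈ I, r x z ∧ r y z

/-- The space of rounded ideals, as a subspace of the space of subsets of `ℕ`. -/
def RI (r : ℕ → ℕ → Prop) : Representation {I : Set ℕ | IsRoundedIdeal r I} :=
  openNat.subspace _

end RepSpace

/-! All computability is reduced to c.e. relations on finite words. A map into `openNat` or
`openSpace δ` is computable once membership is semidecidable from prefixes of names
(`isComputable_openNat`, `isComputable_openSpace`), and computable maps into `openSpace δ` give such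
relations back (`IsComputable.exists_rePred`). An open subset of O(ℕ) is a union of sets {A | F ⊆ A}
with F finite, so a Π⁰₂ set is given by c.e. conditions "if A includes a finite set from `R i`, then
it includes one from `Q i`" (`isPi02_openNat_iff`).

The axioms of rounded ideals are conditions of this kind. Conversely, a Π⁰₂ set S is turned into
ideals by a forcing argument (`exists_computablyIsomorphic_RI`): A in S corresponds to the ideal of
all pairs (F, n) with F a finite subset of A, where (F, n) ≺ (G, m) requires F ⊆ G, n < m, and that
G meets the conditions seen to be triggered by F before stage n.

For (ii) ⇒ (iii), the enumerations of the sets in S are carried over to X (`pullback`). For (iii) ⇒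
(ii), x is sent to the set of prefixes of its names. Fiber-overtness computes this set. It
determines the neighbourhood filter of x, so admissibility computes the inverse
(`computablyIsomorphic_range_namePrefixes`). The range is Π⁰₂ by a construction in the style of
Baire category: a set T of words satisfying suitable Π⁰₂ conditions contains a generic chain, whose
limit names a point with T as its set of prefixes (`isPi02_range_namePrefixes`). -/

section REPred

/-! ### Closure properties of c.e. predicates. -/

open Encodable Nat.Partrec

variable {α β : Type*} [Primcodable α] [Primcodable β]

theorem PrimrecPred.to_re {p : α → Prop} (hp : PrimrecPred p) : REPred p :=
  hp.computablePred.to_re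

theorem REPred.comp {p : β → Prop} (hp : REPred p) {f : α → β} (hf : Computable f) :
    REPred fun a => p (f a) :=
  Partrec.comp hp hf

/-- The stages are the step-bounded evaluations `evaln`. Being decidable, they may be negated and
may be tested inside primitive recursive codes. -/
theorem REPred.exists_stages {p : α → Prop} (hp : REPred p) :
    ∃ Q : α → ℕ → Prop, PrimrecRel Q ∧ (∀ a k l, k ≤ l → Q a k → Q a l) ∧
      ∀ a, p a ↔ ∃ k, Q a k := by
  obtain ⟨c, hc⟩ := Code.exists_code.1 hp
  refine ⟨fun a k => Code.evaln k c (encode a) ≠ Option.none, ?_, ?_, ?_⟩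
  · refine PrimrecPred.not (Primrec.eq.comp ?_ (Primrec.const Option.none))
    exact Code.primrec_evaln.comp
      ((Primrec.snd.pair (Primrec.const c)).pair (Primrec.encode.comp Primrec.fst))
  · intro a k l hkl h
    obtain ⟨x, hx⟩ := Option.ne_none_iff_exists'.1 h
    have := Code.evaln_mono hkl (Option.mem_def.2 hx)
    rw [Option.mem_def.1 this]
    simp
  · intro a
    have key : p a ↔ ∃ x, x ∈ Code.eval c (encode a) := by
      rw [hc]
      simp [encodek]
    rw [key]
    constructor
    · rintro ⟨x, hx⟩
      obtain ⟨k, hk⟩ := Code.evaln_complete.1 hx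
      exact ⟨k, Option.ne_none_iff_exists'.2 ⟨x, hk⟩⟩
    · rintro ⟨k, hk⟩
      obtain ⟨x, hx⟩ := Option.ne_none_iff_exists'.1 hk
      exact ⟨x, Code.evaln_sound (Option.mem_def.2 hx)⟩

theorem REPred.exists_nat_of_primrec {Q : α → ℕ → Prop} (hQ : PrimrecRel Q) :
    REPred fun a => ∃ k, Q a k := by
  classical
  have h := (Partrec.rfind (p := fun a k => Part.some (decide (Q a k)))
    hQ.decide.to_comp.partrec).dom_re
  refine h.of_eq fun a => Nat.rfind_dom.trans ?_
  simp

theorem REPred.proj {p : α × β → Prop} (hp : REPred p) : REPred fun a => ∃ b, p (a, b) := by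
  obtain ⟨Q, hQ, -, h⟩ := hp.exists_stages
  have h1 : PrimrecRel fun (a : α) (n : ℕ) =>
      ∃ b ∈ (decode (α := β) n.unpair.1).toList, Q (a, b) n.unpair.2 := by
    have := (PrimrecRel.exists_mem_list (R := fun (b : β) (x : α × ℕ) => Q (x.1, b) x.2)
      (hQ.comp ((Primrec.fst.comp Primrec.snd).pair Primrec.fst)
        (Primrec.snd.comp Primrec.snd)))
    refine this.comp (f := fun x : α × ℕ => (decode (α := β) x.2.unpair.1).toList)
      (g := fun x : α × ℕ => (x.1, x.2.unpair.2)) ?_ ?_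
    · exact Primrec.optionToList.comp (Primrec.decode.comp
        (Primrec.fst.comp (Primrec.unpair.comp Primrec.snd)))
    · exact Primrec.fst.pair (Primrec.snd.comp (Primrec.unpair.comp Primrec.snd))
  refine (REPred.exists_nat_of_primrec h1).of_eq fun a => ?_
  constructor
  · rintro ⟨n, b, -, hb⟩
    exact ⟨b, (h _).2 ⟨_, hb⟩⟩
  · rintro ⟨b, hb⟩
    obtain ⟨k, hk⟩ := (h _).1 hb
    exact ⟨Nat.pair (encode b) k, b, by simp, by simpa using hk⟩

theorem REPred.exists {p : α → β → Prop} (hp : REPred fun x : α × β => p x.1 x.2) :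
    REPred fun a => ∃ b, p a b :=
  hp.proj

theorem REPred.and {p q : α → Prop} (hp : REPred p) (hq : REPred q) :
    REPred fun a => p a ∧ q a := by
  obtain ⟨P, hP, -, h⟩ := hp.exists_stages
  obtain ⟨Q, hQ, -, h'⟩ := hq.exists_stages
  have h1 : REPred fun x : (α × ℕ) × ℕ => P x.1.1 x.1.2 ∧ Q x.1.1 x.2 :=
    ((hP.comp (Primrec.fst.comp Primrec.fst) (Primrec.snd.comp Primrec.fst)).and
      (hQ.comp (Primrec.fst.comp Primrec.fst) Primrec.snd)).to_re
  refine h1.proj.proj.of_eq fun a => ?_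
  simp [h, h']

theorem REPred.or {p q : α → Prop} (hp : REPred p) (hq : REPred q) :
    REPred fun a => p a ∨ q a := by
  obtain ⟨P, hP, -, h⟩ := hp.exists_stages
  obtain ⟨Q, hQ, -, h'⟩ := hq.exists_stages
  have h1 : REPred fun x : α × ℕ => P x.1 x.2 ∨ Q x.1 x.2 := (PrimrecPred.or hP hQ).to_re
  refine h1.proj.of_eq fun a => ?_
  simp [h, h', exists_or]

/-- As stages are monotone, finitely many members share one stage; the sum of the individual stages
is large enough. -/
theorem REPred.forall_mem {p : α → β → Prop} (hp : REPred fun x : α × β => p x.1 x.2)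
    {l : α → List β} (hl : Computable l) : REPred fun a => ∀ b ∈ l a, p a b := by
  obtain ⟨Q, hQ, hmono, h⟩ := hp.exists_stages
  have h1 : PrimrecRel fun (x : α × List β) (k : ℕ) => ∀ b ∈ x.2, Q (x.1, b) k := by
    have := (PrimrecRel.forall_mem_list (R := fun (b : β) (x : α × ℕ) => Q (x.1, b) x.2)
      (hQ.comp ((Primrec.fst.comp Primrec.snd).pair Primrec.fst)
        (Primrec.snd.comp Primrec.snd)))
    exact this.comp (f := fun x : (α × List β) × ℕ => x.1.2)
      (g := fun x : (α × List β) × ℕ => (x.1.1, x.2)) (Primrec.snd.comp Primrec.fst)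
      ((Primrec.fst.comp Primrec.fst).pair Primrec.snd)
  refine ((REPred.exists_nat_of_primrec h1).comp (Computable.id.pair hl)).of_eq fun a => ?_
  constructor
  · rintro ⟨k, hk⟩ b hb
    exact (h (a, b)).2 ⟨k, hk b hb⟩
  · intro H
    have H' : ∀ b, ∃ k, b ∈ l a → Q (a, b) k := fun b => by
      by_cases hb : b ∈ l a
      · obtain ⟨k, hk⟩ := (h (a, b)).1 (H b hb)
        exact ⟨k, fun _ => hk⟩
      · exact ⟨0, fun h => absurd h hb⟩
    choose f hf using H'
    refine ⟨((l a).map f).sum, fun b hb => hmono _ _ _ ?_ (hf b hb)⟩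
    exact List.le_sum_of_mem (List.mem_map_of_mem hb)

theorem REPred.forall_lt {p : α → ℕ → Prop} (hp : REPred fun x : α × ℕ => p x.1 x.2)
    {f : α → ℕ} (hf : Computable f) : REPred fun a => ∀ i < f a, p a i :=
  (hp.forall_mem (Primrec.list_range.to_comp.comp hf)).of_eq fun a => by simp

end REPred

namespace RepSpace

open Encodable

/-! ### Finite prefixes of sequences. -/

section Prefix

@[simp]
theorem length_prefixOf (p : Baire) (k : ℕ) : (prefixOf p k).length = k := by
  simp [prefixOf]

theorem getElem?_prefixOf {p : Baire} {k i : ℕ} (h : i < k) : (prefixOf p k)[i]? = some (p i) := by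
  simp [prefixOf, h]

theorem getElem?_prefixOf_eq_some {p : Baire} {k i a : ℕ} :
    (prefixOf p k)[i]? = some a ↔ i < k ∧ p i = a := by
  by_cases h : i < k
  · rw [getElem?_prefixOf h]
    simp [h]
  · simp [prefixOf, h]

theorem mem_prefixOf {p : Baire} {k a : ℕ} : a ∈ prefixOf p k ↔ ∃ i < k, p i = a := by
  simp [prefixOf]

theorem take_prefixOf (p : Baire) (k j : ℕ) : (prefixOf p k).take j = prefixOf p (min j k) := by
  simp [prefixOf, ← List.map_take, List.take_range]

theorem prefixOf_mono (p : Baire) {k l : ℕ} (h : k ≤ l) : prefixOf p k <+: prefixOf p l := by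
  rw [← min_eq_left h, ← take_prefixOf]
  exact List.take_prefix _ _

theorem prefixOf_length_of_prefix {p : Baire} {k : ℕ} {w : List ℕ} (h : w <+: prefixOf p k) :
    prefixOf p w.length = w := by
  have h1 := h.length_le
  rw [length_prefixOf] at h1
  have h2 := List.prefix_iff_eq_take.1 h
  rw [take_prefixOf, min_eq_left h1] at h2
  exact h2.symm

theorem prefixOf_eq_iff {p q : Baire} {k : ℕ} :
    prefixOf p k = prefixOf q k ↔ ∀ i < k, p i = q i := by
  simp [prefixOf]

/-- The infinite sequence that starts with `w` and goes on with `p`. -/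
def append (w : List ℕ) (p : Baire) : Baire := fun i =>
  if h : i < w.length then w[i] else p (i - w.length)

theorem prefixOf_append (w : List ℕ) (p : Baire) : prefixOf (append w p) w.length = w := by
  apply List.ext_getElem (by simp)
  intro i h1 h2
  simp [prefixOf, append, h2]

theorem append_add (w : List ℕ) (p : Baire) (i : ℕ) : append w p (w.length + i) = p i := by
  simp [append]

theorem append_mem_or_eq (w : List ℕ) (p : Baire) (i : ℕ) :
    append w p i ∈ w ∨ ∃ j, append w p i = p j := by
  by_cases h : i < w.length
  · left
    simp [append, h]
  · right
    exact ⟨i - w.length, by simp [append, h]⟩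

theorem computable_prefixOf {q : Baire} (hq : Computable q) : Computable (prefixOf q) := by
  have h : Computable fun k : ℕ =>
      (Nat.rec [] (fun n l => l ++ [q n]) k : List ℕ) :=
    Computable.nat_rec Computable.id (Computable.const [])
      (Computable.list_concat.comp (Computable.snd.comp Computable.snd)
        (hq.comp (Computable.fst.comp Computable.snd))).to₂
  refine h.of_eq fun k => ?_
  induction k with
  | zero => rfl
  | succ n ih => simp [ih, prefixOf, List.range_succ]

theorem primrec_prefixOf {β : Type*} [Primcodable β] {f : β → Baire} (hf : Primrec₂ f) :
    Primrec₂ fun b k => prefixOf (f b) k :=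
  Primrec.list_map (Primrec.list_range.comp Primrec.snd)
    (hf.comp (Primrec.fst.comp Primrec.fst) Primrec.snd)

theorem primrecRel_prefix : PrimrecRel fun v w : List ℕ => v <+: w :=
  (Primrec.eq.comp Primrec.fst
    (Primrec.list_take.comp (Primrec.list_length.comp Primrec.fst) Primrec.snd)).of_eq
    fun _ => List.prefix_iff_eq_take.symm

theorem primrecRel_mem : PrimrecRel fun (a : ℕ) (w : List ℕ) => a ∈ w := by
  have h : PrimrecRel fun (w : List ℕ) (a : ℕ) => ∃ b ∈ w, b = a :=
    Primrec.eq.exists_mem_list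
  exact h.swap.of_eq fun a w => by simp [Function.swap]

end Prefix

/-! ### Running a code on finitely much information. -/

section Simulation

/-- The code with prefix `s`, applied to a sequence with prefix `w`, outputs `v` at index `m`. -/
def Outputs (s : List ℕ) (m : ℕ) (w : List ℕ) (v : ℕ) : Prop :=
  ∃ j, j ≤ w.length ∧ s[encode (m, w.take j)]? = some (v + 1) ∧
    ∀ i < j, s[encode (m, w.take i)]? = some 0

theorem Outputs.mono {s t : List ℕ} {m : ℕ} {w u : List ℕ} {v : ℕ} (hs : s <+: t) (hw : w <+: u)
    (h : Outputs s m w v) : Outputs t m u v := by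
  obtain ⟨j, hj, h1, h2⟩ := h
  have key : ∀ i ≤ j, ∀ a, s[encode (m, w.take i)]? = some a →
      t[encode (m, u.take i)]? = some a := by
    intro i hi a ha
    obtain ⟨z, rfl⟩ := hw
    rw [List.take_append_of_le_length (hi.trans hj)]
    obtain ⟨y, rfl⟩ := hs
    obtain ⟨hlt, -⟩ := List.getElem?_eq_some_iff.1 ha
    rwa [List.getElem?_append_left hlt]
  exact ⟨j, hj.trans hw.length_le, key j le_rfl _ h1, fun i hi => key i hi.le _ (h2 i hi)⟩

theorem Outputs.sound {q p r : Baire} (h : App q p r) {k l m v : ℕ}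
    (hv : Outputs (prefixOf q k) m (prefixOf p l) v) : v = r m := by
  obtain ⟨j, hj, h1, h2⟩ := hv
  obtain ⟨j', h1', h2'⟩ := h m
  rw [length_prefixOf] at hj
  have key : ∀ i ≤ j, ∀ a, (prefixOf q k)[encode (m, (prefixOf p l).take i)]? = some a →
      q (query m p i) = a := by
    intro i hi a ha
    rw [take_prefixOf, min_eq_left (hi.trans hj), getElem?_prefixOf_eq_some] at ha
    exact ha.2
  have h3 := key j le_rfl _ h1
  rcases lt_trichotomy j j' with hlt | rfl | hlt
  · have := h2' j hlt
    omega
  · omega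
  · have := key j' hlt.le _ (h2 j' hlt)
    omega

theorem Outputs.complete {q p r : Baire} (h : App q p r) (m : ℕ) :
    ∃ k, Outputs (prefixOf q k) m (prefixOf p k) (r m) := by
  obtain ⟨j, h1, h2⟩ := h m
  -- Larger than `j`, so that enough input is present, and larger than all queries up to `j`, so
  -- that the prefix of `q` contains their answers.
  let k := j + (((List.range (j + 1)).map (query m p)).sum + 1)
  have hk : ∀ i ≤ j, query m p i < k := fun i hi => by
    have := List.le_sum_of_mem (List.mem_map_of_mem (f := query m p)
      (List.mem_range.2 (show i < j + 1 by omega)))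
    omega
  have key : ∀ i ≤ j, (prefixOf q k)[encode (m, (prefixOf p k).take i)]? =
      some (q (query m p i)) := by
    intro i hi
    rw [take_prefixOf, min_eq_left (by omega)]
    exact getElem?_prefixOf (hk i hi)
  exact ⟨k, j, by simp [k], by rw [key j le_rfl, h1], fun i hi => by rw [key i hi.le, h2 i hi]⟩

theorem rePred_outputs :
    REPred fun x : (List ℕ × ℕ) × (List ℕ × ℕ) => Outputs x.1.1 x.1.2 x.2.1 x.2.2 := by
  have hget : Primrec fun y : ((List ℕ × ℕ) × (List ℕ × ℕ)) × ℕ =>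
      y.1.1.1[encode (y.1.1.2, y.1.2.1.take y.2)]? :=
    Primrec.list_getElem?.comp (Primrec.fst.comp (Primrec.fst.comp Primrec.fst))
      (Primrec.encode.comp ((Primrec.snd.comp (Primrec.fst.comp Primrec.fst)).pair
        (Primrec.list_take.comp Primrec.snd
          (Primrec.fst.comp (Primrec.snd.comp Primrec.fst)))))
  refine REPred.exists (REPred.and ?_ (REPred.and ?_ (REPred.forall_lt ?_ Computable.snd)))
  · exact (Primrec.nat_le.comp Primrec.snd
      (Primrec.list_length.comp (Primrec.fst.comp (Primrec.snd.comp Primrec.fst)))).to_re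
  · exact (Primrec.eq.comp hget (Primrec.option_some.comp (Primrec.succ.comp
      (Primrec.snd.comp (Primrec.snd.comp Primrec.fst))))).to_re
  · exact (Primrec.eq.comp (hget.comp ((Primrec.fst.comp Primrec.fst).pair Primrec.snd))
      (Primrec.const (some 0))).to_re

/-- The code with prefix `s`, applied to a sequence with prefix `w`, has output with prefix `u`. -/
def OutputsList (s w u : List ℕ) : Prop :=
  ∀ a < u.length, Outputs s a w (u.getD a 0)

theorem OutputsList.mono {s t w v u : List ℕ} (hs : s <+: t) (hw : w <+: v)
    (h : OutputsList s w u) : OutputsList t v u :=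
  fun a ha => (h a ha).mono hs hw

theorem OutputsList.sound {q p r : Baire} (h : App q p r) {k l : ℕ} {u : List ℕ}
    (hu : OutputsList (prefixOf q k) (prefixOf p l) u) : u = prefixOf r u.length := by
  apply List.ext_getElem (by simp)
  intro i h1 h2
  have := (hu i h1).sound h
  simpa [prefixOf, h1] using this

theorem OutputsList.complete {q p r : Baire} (h : App q p r) (m : ℕ) :
    ∃ k, OutputsList (prefixOf q k) (prefixOf p k) (prefixOf r m) := by
  choose f hf using Outputs.complete h
  refine ⟨((List.range m).map f).sum, fun a ha => ?_⟩
  rw [length_prefixOf] at ha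
  have h1 : f a ≤ ((List.range m).map f).sum :=
    List.le_sum_of_mem (List.mem_map_of_mem (List.mem_range.2 ha))
  have h2 : (prefixOf r m).getD a 0 = r a := by
    simp [List.getD, getElem?_prefixOf ha]
  rw [h2]
  exact (hf a).mono (prefixOf_mono _ h1) (prefixOf_mono _ h1)

theorem rePred_outputsList :
    REPred fun x : (List ℕ × List ℕ) × List ℕ => OutputsList x.1.1 x.1.2 x.2 := by
  refine REPred.forall_lt ?_ (Primrec.list_length.comp Primrec.snd).to_comp
  refine rePred_outputs.comp (f := fun y : ((List ℕ × List ℕ) × List ℕ) × ℕ =>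
    ((y.1.1.1, y.2), (y.1.1.2, y.1.2.getD y.2 0))) (Primrec.to_comp ?_)
  exact ((Primrec.fst.comp (Primrec.fst.comp Primrec.fst)).pair Primrec.snd).pair
    ((Primrec.snd.comp (Primrec.fst.comp Primrec.fst)).pair
      ((Primrec.list_getD 0).comp (Primrec.snd.comp Primrec.fst) Primrec.snd))

/-- The code of an open set that has prefix `s` accepts the sequences with prefix `w`. -/
def Accepts (s w : List ℕ) : Prop := ∃ m v, Outputs s m w (v + 1)

theorem Accepts.mono {s t w u : List ℕ} (hs : s <+: t) (hw : w <+: u)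
    (h : Accepts s w) : Accepts t u := by
  obtain ⟨m, v, h⟩ := h
  exact ⟨m, v, h.mono hs hw⟩

theorem rePred_accepts : REPred fun x : List ℕ × List ℕ => Accepts x.1 x.2 := by
  refine REPred.exists (REPred.exists ?_)
  refine rePred_outputs.comp (f := fun y : ((List ℕ × List ℕ) × ℕ) × ℕ =>
    ((y.1.1.1, y.1.2), (y.1.1.2, y.2 + 1))) (Primrec.to_comp ?_)
  exact ((Primrec.fst.comp (Primrec.fst.comp Primrec.fst)).pair (Primrec.snd.comp Primrec.fst)).pair
    ((Primrec.snd.comp (Primrec.fst.comp Primrec.fst)).pair (Primrec.succ.comp Primrec.snd))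

/-- This turns statements about open sets into statements about finite words. -/
theorem accepts_iff {X : Type*} {δ : Representation X} {c p : Baire} {U : OpenSet δ} {x : X}
    (hc : (openSpace δ).IsName c U) (hp : δ.IsName p x) :
    x ∈ U ↔ ∃ k l, Accepts (prefixOf c k) (prefixOf p l) := by
  obtain ⟨r, hr, hr'⟩ := hc p x hp
  refine hr'.trans ⟨?_, ?_⟩
  · rintro ⟨m, hm⟩
    obtain ⟨k, hk⟩ := Outputs.complete hr m
    exact ⟨k, k, m, r m - 1, by rwa [Nat.sub_add_cancel (Nat.one_le_iff_ne_zero.2 hm)]⟩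
  · rintro ⟨k, l, m, v, h⟩
    exact ⟨m, by rw [← h.sound hr]; simp⟩

end Simulation

/-! ### Computable codes from c.e. relations. -/

section Codes

/-- The code dovetails: after reading j symbols it tries the first j triples of a value, a prefix
length and a stage, and answers with the first value confirmed, or else reads on. All confirmed
values equal `r n`, so the order of the search is irrelevant, and longer inputs allow longer
searches. -/
theorem exists_code {R : ℕ → List ℕ → ℕ → Prop}
    (hR : REPred fun x : ℕ × (List ℕ × ℕ) => R x.1 x.2.1 x.2.2) :
    ∃ q, Computable q ∧ ∀ p r, (∀ n, ∃ k, R n (prefixOf p k) (r n)) →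
      (∀ n k v, R n (prefixOf p k) v → v = r n) → App q p r := by
  classical
  obtain ⟨Q, hQ, -, h⟩ := hR.exists_stages
  let D : ℕ → ℕ × (ℕ × ℕ) := Denumerable.ofNat (ℕ × (ℕ × ℕ))
  let g : ℕ × List ℕ → ℕ → Option ℕ := fun x t =>
    if Q (x.1, (x.2.take (D t).2.1, (D t).1)) (D t).2.2 then some (D t).1 else none
  let q : ℕ → ℕ := fun c =>
    let x := Denumerable.ofNat (ℕ × List ℕ) c
    ((((List.range x.2.length).filterMap (g x)).head?.map Nat.succ).getD 0)
  have hD : Primrec D := Primrec.ofNat _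
  have hg : Primrec₂ g := by
    have hDt : Primrec fun y : (ℕ × List ℕ) × ℕ => D y.2 := hD.comp Primrec.snd
    refine Primrec.ite (hQ.comp ?_ (Primrec.snd.comp (Primrec.snd.comp hDt)))
      (Primrec.option_some.comp (Primrec.fst.comp hDt)) (Primrec.const none)
    exact (Primrec.fst.comp Primrec.fst).pair ((Primrec.list_take.comp
      (Primrec.fst.comp (Primrec.snd.comp hDt)) (Primrec.snd.comp Primrec.fst)).pair
      (Primrec.fst.comp hDt))
  have hq : Primrec q := by
    have hx : Primrec fun c : ℕ => Denumerable.ofNat (ℕ × List ℕ) c := Primrec.ofNat _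
    refine Primrec.option_getD.comp (Primrec.option_map (Primrec.list_head?.comp
      (Primrec.listFilterMap (Primrec.list_range.comp (Primrec.list_length.comp
        (Primrec.snd.comp hx))) (hg.comp (hx.comp Primrec.fst) Primrec.snd)))
      (Primrec.succ.comp Primrec.snd)) (Primrec.const 0)
  refine ⟨q, hq.to_comp, fun p r h1 h2 n => ?_⟩
  have hqq : ∀ j, q (query n p j) =
      (((List.range j).filterMap (g (n, prefixOf p j))).head?.map Nat.succ).getD 0 := by
    intro j
    simp only [q, query, Denumerable.ofNat_encode, length_prefixOf]
  have hsound : ∀ j t v, g (n, prefixOf p j) t = some v → v = r n := by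
    intro j t v hv
    simp only [g, take_prefixOf] at hv
    split_ifs at hv with hc
    simp only [Option.some.injEq] at hv
    subst hv
    exact h2 n _ _ ((h _).2 ⟨_, hc⟩)
  have hval : ∀ j, q (query n p j) = 0 ∨ q (query n p j) = r n + 1 := by
    intro j
    rw [hqq]
    rcases ho : ((List.range j).filterMap (g (n, prefixOf p j))).head? with - | v
    · simp
    · right
      have hmem := List.mem_of_mem_head? (Option.mem_def.2 ho)
      obtain ⟨t, -, ht⟩ := List.mem_filterMap.1 hmem
      simp [hsound _ _ _ ht]
  have hex : ∃ j, q (query n p j) ≠ 0 := by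
    obtain ⟨k, hk⟩ := h1 n
    obtain ⟨l, hl⟩ := (h (n, (prefixOf p k, r n))).1 hk
    let t := encode ((r n, (k, l)) : ℕ × (ℕ × ℕ))
    -- Above `t`, so that the search reaches this triple, and above `k`, so that cutting the input
    -- down to `k` symbols gives the prefix that works.
    refine ⟨t + k + 1, ?_⟩
    rw [hqq]
    have ht : g (n, prefixOf p (t + k + 1)) t = some (r n) := by
      have hDt : D t = (r n, (k, l)) := Denumerable.ofNat_encode _
      simp only [g, take_prefixOf, hDt]
      rw [min_eq_left (by omega), if_pos hl]
    have hmem : r n ∈ (List.range (t + k + 1)).filterMap (g (n, prefixOf p (t + k + 1))) :=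
      List.mem_filterMap.2 ⟨t, by simp, ht⟩
    rcases ho : ((List.range (t + k + 1)).filterMap (g (n, prefixOf p (t + k + 1)))) with - | ⟨v, L⟩
    · rw [ho] at hmem
      simp at hmem
    · simp
  refine ⟨Nat.find hex, ?_, fun j hj => by simpa using Nat.find_min hex hj⟩
  exact (hval _).resolve_left (Nat.find_spec hex)

theorem exists_code_of_primrec {f : ℕ → List ℕ → ℕ} (hf : Primrec₂ f) {l : ℕ → ℕ}
    (hl : Primrec l) :
    ∃ q, Computable q ∧ ∀ p, App q p fun n => f n (prefixOf p (l n)) := by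
  have hR : REPred fun x : ℕ × (List ℕ × ℕ) => x.2.1.length = l x.1 ∧ x.2.2 = f x.1 x.2.1 := by
    refine (PrimrecPred.and (Primrec.eq.comp ?_ ?_) (Primrec.eq.comp ?_ ?_)).to_re
    · exact Primrec.list_length.comp (Primrec.fst.comp Primrec.snd)
    · exact hl.comp Primrec.fst
    · exact Primrec.snd.comp Primrec.snd
    · exact hf.comp Primrec.fst (Primrec.fst.comp Primrec.snd)
  obtain ⟨q, hq, h⟩ := exists_code (R := fun n w v => w.length = l n ∧ v = f n w) hR
  refine ⟨q, hq, fun p => h p _ (fun n => ⟨l n, by simp⟩) ?_⟩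
  rintro n k v ⟨h1, h2⟩
  rw [length_prefixOf] at h1
  rw [h2, h1]

end Codes

/-! ### Computable maps as c.e. relations between prefixes. -/

section Maps

universe w

variable {X : Type u} {Y : Type v} {Z : Type w} {δ : Representation X} {γ : Representation Y}
  {ε : Representation Z}

/-- The first code is run on the prefix read so far, and the finite piece of output obtained is fed
to the second. -/
theorem IsComputable.comp {g : Y → Z} {f : X → Y} (hg : IsComputable γ ε g)
    (hf : IsComputable δ γ f) : IsComputable δ ε fun x => g (f x) := by
  obtain ⟨q₁, hq₁, h₁⟩ := hf
  obtain ⟨q₂, hq₂, h₂⟩ := hg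
  have hR : REPred fun x : ℕ × (List ℕ × ℕ) => ∃ (k : ℕ) (u : List ℕ),
      OutputsList (prefixOf q₁ k) x.2.1 u ∧ Outputs (prefixOf q₂ k) x.1 u x.2.2 := by
    refine REPred.exists (REPred.exists (REPred.and ?_ ?_))
    · refine rePred_outputsList.comp (f := fun y : ((ℕ × (List ℕ × ℕ)) × ℕ) × List ℕ =>
        ((prefixOf q₁ y.1.2, y.1.1.2.1), y.2)) ?_
      refine Computable.pair (Computable.pair ((computable_prefixOf hq₁).comp ?_) ?_)
        Computable.snd
      · exact Computable.snd.comp Computable.fst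
      · exact Computable.fst.comp (Computable.snd.comp (Computable.fst.comp Computable.fst))
    · refine rePred_outputs.comp (f := fun y : ((ℕ × (List ℕ × ℕ)) × ℕ) × List ℕ =>
        ((prefixOf q₂ y.1.2, y.1.1.1), (y.2, y.1.1.2.2))) ?_
      refine Computable.pair (Computable.pair ((computable_prefixOf hq₂).comp ?_) ?_)
        (Computable.pair Computable.snd ?_)
      · exact Computable.snd.comp Computable.fst
      · exact Computable.fst.comp (Computable.fst.comp Computable.fst)
      · exact Computable.snd.comp (Computable.snd.comp (Computable.fst.comp Computable.fst))
  obtain ⟨q, hq, h⟩ := exists_code (R := fun n w v => ∃ (k : ℕ) (u : List ℕ),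
    OutputsList (prefixOf q₁ k) w u ∧ Outputs (prefixOf q₂ k) n u v) hR
  refine ⟨q, hq, fun p x hp => ?_⟩
  obtain ⟨r, hr, hr'⟩ := h₁ p x hp
  obtain ⟨s, hs, hs'⟩ := h₂ r _ hr'
  refine ⟨s, h p s ?_ ?_, hs'⟩
  · intro n
    obtain ⟨k, hk⟩ := Outputs.complete hs n
    obtain ⟨l, hl⟩ := OutputsList.complete hr k
    refine ⟨l, k + l, prefixOf r k, hl.mono (prefixOf_mono _ (by omega)) List.prefix_rfl,
      hk.mono (prefixOf_mono _ (by omega)) List.prefix_rfl⟩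
  · rintro n k v ⟨l, u, hu, hv⟩
    rw [hu.sound hr] at hv
    exact hv.sound hs

/-- Output position i codes a triple (k, n, l): it lists n if stage l confirms `H` for n and the
first k input symbols. Otherwise it holds 0, which lists nothing. -/
theorem isComputable_openNat {f : Y → Set ℕ} {H : List ℕ → ℕ → Prop}
    (hH : REPred fun x : List ℕ × ℕ => H x.1 x.2)
    (h : ∀ p y, γ.IsName p y → ∀ n, n ∈ f y ↔ ∃ k, H (prefixOf p k) n) :
    IsComputable γ openNat f := by
  classical
  obtain ⟨Q, hQ, -, hQ'⟩ := hH.exists_stages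
  let D : ℕ → ℕ × (ℕ × ℕ) := Denumerable.ofNat (ℕ × (ℕ × ℕ))
  have hD : Primrec D := Primrec.ofNat _
  have hDt : Primrec fun y : ℕ × List ℕ => D y.1 := hD.comp Primrec.fst
  obtain ⟨q, hq, hq'⟩ := exists_code_of_primrec
    (f := fun i w => if Q (w, (D i).2.1) (D i).2.2 then (D i).2.1 + 1 else 0)
    (l := fun i => (D i).1) (Primrec.ite (hQ.comp (Primrec.snd.pair
      (Primrec.fst.comp (Primrec.snd.comp hDt))) (Primrec.snd.comp (Primrec.snd.comp hDt)))
      (Primrec.succ.comp (Primrec.fst.comp (Primrec.snd.comp hDt))) (Primrec.const 0))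
    (Primrec.fst.comp hD)
  refine ⟨q, hq, fun p y hp => ⟨_, hq' p, ?_⟩⟩
  ext n
  rw [h p y hp]
  constructor
  · rintro ⟨k, hk⟩
    obtain ⟨l, hl⟩ := (hQ' (prefixOf p k, n)).1 hk
    have hDt : D (encode ((k, (n, l)) : ℕ × (ℕ × ℕ))) = (k, (n, l)) := Denumerable.ofNat_encode _
    refine ⟨encode ((k, (n, l)) : ℕ × (ℕ × ℕ)), ?_⟩
    simp only [hDt]
    rw [if_pos hl]
  · rintro ⟨i, hi⟩
    simp only at hi
    split_ifs at hi with hc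
    obtain rfl : (D i).2.1 = n := by omega
    exact ⟨_, (hQ' _).2 ⟨_, hc⟩⟩

theorem isComputable_openSpace {f : Y → OpenSet δ} {H : List ℕ → List ℕ → Prop}
    (hH : REPred fun x : List ℕ × List ℕ => H x.1 x.2)
    (h : ∀ p y p' x, γ.IsName p y → δ.IsName p' x →
      (x ∈ f y ↔ ∃ k l, H (prefixOf p k) (prefixOf p' l))) :
    IsComputable γ (openSpace δ) f := by
  classical
  obtain ⟨Q, hQ, -, hQ'⟩ := hH.exists_stages
  let D : ℕ → ℕ × (ℕ × ℕ) := Denumerable.ofNat (ℕ × (ℕ × ℕ))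
  have hD : Primrec D := Primrec.ofNat _
  let C : ℕ → ℕ × List ℕ := Denumerable.ofNat (ℕ × List ℕ)
  have hC : Primrec C := Primrec.ofNat _
  -- Entry `c` is the answer to a query (m, v), where m codes (k, l, t). The answer 0 reads on until
  -- v has length l; then 2 stands for the output symbol 1 and 1 for the symbol 0. Only the first k
  -- symbols of the name are needed.
  let f' : ℕ → List ℕ → ℕ := fun c w =>
    if (C c).2.length = (D (C c).1).2.1 then
      if Q (w, (C c).2) (D (C c).1).2.2 then 2 else 1 else 0
  have hf' : Primrec₂ f' := by
    have h1 : Primrec fun y : ℕ × List ℕ => C y.1 := hC.comp Primrec.fst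
    have h2 : Primrec fun y : ℕ × List ℕ => D (C y.1).1 := hD.comp (Primrec.fst.comp h1)
    refine Primrec.ite (Primrec.eq.comp (Primrec.list_length.comp (Primrec.snd.comp h1))
      (Primrec.fst.comp (Primrec.snd.comp h2))) (Primrec.ite (hQ.comp (Primrec.snd.pair
        (Primrec.snd.comp h1)) (Primrec.snd.comp (Primrec.snd.comp h2))) (Primrec.const 2)
        (Primrec.const 1)) (Primrec.const 0)
  obtain ⟨q, hq, hq'⟩ := exists_code_of_primrec hf'
    (l := fun c => (D (C c).1).1) (Primrec.fst.comp (hD.comp (Primrec.fst.comp hC)))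
  refine ⟨q, hq, fun p y hp => ⟨_, hq' p, fun p' x hp' => ?_⟩⟩
  refine ⟨fun m => if Q (prefixOf p (D m).1, prefixOf p' (D m).2.1) (D m).2.2 then 1 else 0,
    fun m => ⟨(D m).2.1, ?_, fun j hj => ?_⟩, ?_⟩
  · have : C (query m p' (D m).2.1) = (m, prefixOf p' (D m).2.1) := Denumerable.ofNat_encode _
    simp only [f', this, length_prefixOf, if_true]
    split_ifs <;> rfl
  · have : C (query m p' j) = (m, prefixOf p' j) := Denumerable.ofNat_encode _
    simp only [f', this, length_prefixOf, if_neg hj.ne]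
  · refine (h p y p' x hp hp').trans ⟨?_, ?_⟩
    · rintro ⟨k, l, hkl⟩
      obtain ⟨t, ht⟩ := (hQ' (prefixOf p k, prefixOf p' l)).1 hkl
      have hDt : D (encode ((k, (l, t)) : ℕ × (ℕ × ℕ))) = (k, (l, t)) := Denumerable.ofNat_encode _
      refine ⟨encode ((k, (l, t)) : ℕ × (ℕ × ℕ)), ?_⟩
      simp only [hDt]
      rw [if_pos ht]
      simp
    · rintro ⟨m, hm⟩
      simp only at hm
      split_ifs at hm with hc
      · exact ⟨_, _, (hQ' _).2 ⟨_, hc⟩⟩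
      · exact absurd rfl hm

theorem IsComputable.exists_rePred {f : Y → OpenSet δ} (hf : IsComputable γ (openSpace δ) f) :
    ∃ H : List ℕ → List ℕ → Prop, REPred (fun x : List ℕ × List ℕ => H x.1 x.2) ∧
      (∀ s t w u, s <+: t → w <+: u → H s w → H t u) ∧
      ∀ p y p' x, γ.IsName p y → δ.IsName p' x →
        (x ∈ f y ↔ ∃ k l, H (prefixOf p k) (prefixOf p' l)) := by
  obtain ⟨q, hq, h⟩ := hf
  refine ⟨fun s w => ∃ (k : ℕ) (u : List ℕ), OutputsList (prefixOf q k) s u ∧ Accepts u w,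
    ?_, ?_, ?_⟩
  · refine REPred.exists (REPred.exists (REPred.and ?_ ?_))
    · refine rePred_outputsList.comp (f := fun y : ((List ℕ × List ℕ) × ℕ) × List ℕ =>
        ((prefixOf q y.1.2, y.1.1.1), y.2)) ?_
      exact Computable.pair (Computable.pair ((computable_prefixOf hq).comp
        (Computable.snd.comp Computable.fst))
        (Computable.fst.comp (Computable.fst.comp Computable.fst))) Computable.snd
    · exact rePred_accepts.comp (f := fun y : ((List ℕ × List ℕ) × ℕ) × List ℕ => (y.2, y.1.1.2))
        (Computable.pair Computable.snd (Computable.snd.comp (Computable.fst.comp Computable.fst)))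
  · rintro s t w u hs hw ⟨k, c, h1, h2⟩
    exact ⟨k, c, h1.mono List.prefix_rfl hs, h2.mono List.prefix_rfl hw⟩
  · intro p y p' x hp hp'
    obtain ⟨r, hr, hr'⟩ := h p y hp
    rw [accepts_iff hr' hp']
    constructor
    · rintro ⟨k, l, hkl⟩
      obtain ⟨m, hm⟩ := OutputsList.complete hr k
      exact ⟨m, l, m, _, hm, hkl⟩
    · rintro ⟨m, l, k, u, h1, h2⟩
      rw [h1.sound hr] at h2
      exact ⟨_, _, h2⟩

/-- Evaluation is symmetric: this is the acceptance relation with its arguments exchanged. -/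
theorem isComputable_nbhds (δ : Representation X) :
    IsComputable δ (openSpace (openSpace δ)) (nbhds δ) := by
  refine isComputable_openSpace (H := fun s w => Accepts w s)
    (rePred_accepts.comp (Computable.snd.pair Computable.fst)) fun p x c U hp hc => ?_
  rw [exists_comm]
  exact accepts_iff (δ := δ) (U := U) hc hp

/-- A code of the open set of all points with a name that has a prefix satisfying `h`. -/
def openCode (h : List ℕ → Prop) [DecidablePred h] : Baire := fun c =>
  let x := Denumerable.ofNat (ℕ × List ℕ) c
  if x.2.length = x.1 then (if h x.2 then 2 else 1) else 0

theorem realizes_openCode {h : List ℕ → Prop} [DecidablePred h] {s : X → Prop}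
    (hs : ∀ p x, δ.IsName p x → (s x ↔ ∃ k, h (prefixOf p k))) :
    Realizes δ sierpinski (openCode h) s := by
  intro p x hp
  refine ⟨fun m => if h (prefixOf p m) then 1 else 0, fun m => ⟨m, ?_, fun j hj => ?_⟩, ?_⟩
  · simp only [openCode, query, Denumerable.ofNat_encode, length_prefixOf, if_true]
    split_ifs <;> rfl
  · simp [openCode, query, Denumerable.ofNat_encode, hj.ne]
  · simp [sierpinski, hs p x hp]

theorem primrec_openCode {β : Type*} [Primcodable β] {h : β → List ℕ → Prop}
    [∀ b, DecidablePred (h b)] (hh : PrimrecRel h) : Primrec₂ fun b => openCode (h b) := by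
  have hx : Primrec fun y : β × ℕ => Denumerable.ofNat (ℕ × List ℕ) y.2 :=
    (Primrec.ofNat _).comp Primrec.snd
  exact Primrec.ite (Primrec.eq.comp (Primrec.list_length.comp (Primrec.snd.comp hx))
    (Primrec.fst.comp hx)) (Primrec.ite (hh.comp Primrec.fst (Primrec.snd.comp hx))
    (Primrec.const 2) (Primrec.const 1)) (Primrec.const 0)

end Maps

end RepSpace

namespace RepSpace

open Encodable

section Isomorphism

universe w

variable {X : Type u} {Y : Type v} {Z : Type w} {δ : Representation X} {γ : Representation Y}
  {ε : Representation Z}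

theorem ComputablyIsomorphic.trans (h : ComputablyIsomorphic δ γ)
    (h' : ComputablyIsomorphic γ ε) : ComputablyIsomorphic δ ε := by
  obtain ⟨e, h1, h2⟩ := h
  obtain ⟨e', h1', h2'⟩ := h'
  exact ⟨e.trans e', h1'.comp h1, h2.comp h2'⟩

end Isomorphism

/-! ### Open and Π⁰₂ subsets of O(ℕ). -/

section OpenNat

theorem exists_prefix_of_subset {p : Baire} {A : Set ℕ} (hp : openNat.IsName p A) {F : List ℕ}
    (hF : ∀ n ∈ F, n ∈ A) : ∃ k, ∀ n ∈ F, n + 1 ∈ prefixOf p k := by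
  induction F with
  | nil => exact ⟨0, by simp⟩
  | cons a F ih =>
    obtain ⟨k, hk⟩ := ih fun n hn => hF n (List.mem_cons_of_mem _ hn)
    have ha : a ∈ {n | ∃ i, p i = n + 1} := hp ▸ hF a List.mem_cons_self
    obtain ⟨i, hi⟩ := ha
    refine ⟨k + i + 1, fun n hn => ?_⟩
    rcases List.mem_cons.1 hn with rfl | hn
    · exact mem_prefixOf.2 ⟨i, by omega, hi⟩
    · exact (prefixOf_mono p (by omega)).subset (hk n hn)

theorem mem_of_mem_prefixOf {p : Baire} {A : Set ℕ} (hp : openNat.IsName p A) {k n : ℕ}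
    (h : n + 1 ∈ prefixOf p k) : n ∈ A := by
  obtain ⟨i, -, hi⟩ := mem_prefixOf.1 h
  rw [show A = _ from hp]
  exact ⟨i, hi⟩

/-- Every finite word that lists only members of A therefore begins a name of A. Both the form of
the open sets of O(ℕ) and the overtness of the fibers rest on this. -/
theorem isName_append {p : Baire} {A : Set ℕ} (hp : openNat.IsName p A) {w : List ℕ}
    (hw : ∀ n, n + 1 ∈ w → n ∈ A) : openNat.IsName (append w p) A := by
  ext n
  constructor
  · intro h
    rw [show A = _ from hp] at h
    obtain ⟨i, hi⟩ := h
    exact ⟨w.length + i, by rw [append_add, hi]⟩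
  · rintro ⟨i, hi⟩
    rcases append_mem_or_eq w p i with h | ⟨j, h⟩
    · exact hw n (hi ▸ h)
    · rw [show A = _ from hp]
      exact ⟨j, by rw [← h, hi]⟩

/-- The open set of all `A` that include one of the finite sets in `R`. -/
def Covers (R : List ℕ → Prop) (A : Set ℕ) : Prop := ∃ F, R F ∧ ∀ n ∈ F, n ∈ A

theorem covers_iff {R : List ℕ → Prop} {p : Baire} {A : Set ℕ} (hp : openNat.IsName p A) :
    Covers R A ↔ ∃ k, ∃ F, R F ∧ ∀ n ∈ F, n + 1 ∈ prefixOf p k := by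
  constructor
  · rintro ⟨F, hR, hF⟩
    obtain ⟨k, hk⟩ := exists_prefix_of_subset hp hF
    exact ⟨k, F, hR, hk⟩
  · rintro ⟨k, F, hR, hF⟩
    exact ⟨F, hR, fun n hn => mem_of_mem_prefixOf hp (hF n hn)⟩

theorem prefixOf_const (a k : ℕ) : prefixOf (fun _ => a) k = List.replicate k a := by
  apply List.ext_getElem <;> simp [prefixOf]

theorem primrec_replicate : Primrec₂ fun a k : ℕ => List.replicate k a :=
  (primrec_prefixOf (f := fun a _ : ℕ => a) Primrec.fst).of_eq fun a k => prefixOf_const a k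

/-- The uniformly c.e. families of open sets of any represented space. -/
theorem IsComputable.exists_rePred_nat {X : Type u} {δ : Representation X} {U : ℕ → OpenSet δ}
    (hU : IsComputable nat (openSpace δ) U) :
    ∃ W : ℕ → List ℕ → Prop, REPred (fun x : ℕ × List ℕ => W x.1 x.2) ∧
      (∀ i v w, v <+: w → W i v → W i w) ∧
      ∀ i p x, δ.IsName p x → (x ∈ U i ↔ ∃ k, W i (prefixOf p k)) := by
  obtain ⟨H, hH, hmono, h⟩ := hU.exists_rePred
  -- The constant sequence `i` is a name of `i`.
  refine ⟨fun i w => ∃ k, H (List.replicate k i) w, ?_, ?_, ?_⟩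
  · refine REPred.exists (hH.comp (f := fun y : (ℕ × List ℕ) × ℕ =>
      (List.replicate y.2 y.1.1, y.1.2)) (Primrec.to_comp (Primrec.pair ?_ ?_)))
    · exact primrec_replicate.comp (Primrec.fst.comp Primrec.fst) Primrec.snd
    · exact Primrec.snd.comp Primrec.fst
  · rintro i v w hvw ⟨k, hk⟩
    exact ⟨k, hmono _ _ _ _ List.prefix_rfl hvw hk⟩
  · intro i p x hp
    rw [h (fun _ => i) i p x rfl hp, exists_comm]
    simp only [prefixOf_const]

/-- If A includes all that an accepted word lists, then that word begins a name of A, and A lies in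
`U i`. So the accepted words yield the finite sets. -/
theorem IsComputable.exists_covers {U : ℕ → OpenSet openNat}
    (hU : IsComputable nat (openSpace openNat) U) :
    ∃ R : ℕ → List ℕ → Prop, REPred (fun x : ℕ × List ℕ => R x.1 x.2) ∧
      ∀ i A, A ∈ U i ↔ Covers (R i) A := by
  obtain ⟨W, hW, -, h⟩ := hU.exists_rePred_nat
  -- An entry 0 lists nothing; any other entry `a` lists `a - 1`.
  refine ⟨fun i F => ∃ w, W i w ∧ ∀ a ∈ w, a = 0 ∨ a - 1 ∈ F, ?_, ?_⟩
  · refine REPred.exists (REPred.and ?_ (PrimrecPred.to_re ?_))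
    · exact hW.comp (f := fun y : (ℕ × List ℕ) × List ℕ => (y.1.1, y.2))
        ((Computable.fst.comp Computable.fst).pair Computable.snd)
    · have : PrimrecRel fun (a : ℕ) (F : List ℕ) => a = 0 ∨ a - 1 ∈ F :=
        PrimrecPred.or (Primrec.eq.comp Primrec.fst (Primrec.const 0))
          (primrecRel_mem.comp (Primrec.pred.comp Primrec.fst) Primrec.snd)
      exact this.forall_mem_list.comp Primrec.snd (Primrec.snd.comp Primrec.fst)
  · intro i A
    obtain ⟨p, hp⟩ := openNat.surj A
    constructor
    · intro hA
      obtain ⟨k, hk⟩ := (h i p A hp).1 hA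
      refine ⟨((prefixOf p k).filter (· ≠ 0)).map Nat.pred, ⟨_, hk, fun a ha => ?_⟩, ?_⟩
      · by_cases h0 : a = 0
        · exact Or.inl h0
        · exact Or.inr (List.mem_map.2 ⟨a, List.mem_filter.2 ⟨ha, by simpa using h0⟩, rfl⟩)
      · intro n hn
        obtain ⟨a, ha, rfl⟩ := List.mem_map.1 hn
        obtain ⟨ha, h0⟩ := List.mem_filter.1 ha
        have h0 : a ≠ 0 := by simpa using h0
        exact mem_of_mem_prefixOf hp (by rwa [← Nat.succ_eq_add_one, Nat.succ_pred h0])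
    · rintro ⟨F, ⟨w, hw, hwF⟩, hF⟩
      have hq : openNat.IsName (append w p) A := isName_append hp fun n hn => by
        simpa using hF _ ((hwF _ hn).resolve_left (Nat.succ_ne_zero n))
      exact (h i _ A hq).2 ⟨w.length, by rwa [prefixOf_append]⟩

theorem exists_openSet_covers {R : ℕ → List ℕ → Prop}
    (hR : REPred fun x : ℕ × List ℕ => R x.1 x.2) :
    ∃ U : ℕ → OpenSet openNat, IsComputable nat (openSpace openNat) U ∧
      ∀ i A, A ∈ U i ↔ Covers (R i) A := by
  classical
  refine ⟨fun i => ⟨Covers (R i), _, realizes_openCode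
    (h := fun w => ∃ F, R i F ∧ ∀ n ∈ F, n + 1 ∈ w) fun p A hp => covers_iff hp⟩, ?_,
    fun i A => Iff.rfl⟩
  refine isComputable_openSpace (H := fun s w => ∃ i F, s.head? = some i ∧ R i F ∧
    ∀ n ∈ F, n + 1 ∈ w) ?_ ?_
  · refine REPred.exists (REPred.exists (REPred.and ?_ (REPred.and ?_ ?_)))
    · exact (Primrec.eq.comp (Primrec.list_head?.comp
        (Primrec.fst.comp (Primrec.fst.comp Primrec.fst)))
        (Primrec.option_some.comp (Primrec.snd.comp Primrec.fst))).to_re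
    · exact hR.comp (f := fun y : ((List ℕ × List ℕ) × ℕ) × List ℕ => (y.1.2, y.2))
        ((Computable.snd.comp Computable.fst).pair Computable.snd)
    · have : PrimrecRel fun (n : ℕ) (w : List ℕ) => n + 1 ∈ w :=
        primrecRel_mem.comp (Primrec.succ.comp Primrec.fst) Primrec.snd
      exact (this.forall_mem_list.comp Primrec.snd
        (Primrec.snd.comp (Primrec.fst.comp Primrec.fst))).to_re
  · intro p i p' A hp hp'
    have hp : p 0 = i := hp
    refine (covers_iff hp').trans ⟨?_, ?_⟩
    · rintro ⟨l, F, hF⟩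
      exact ⟨1, l, i, F, by simp [prefixOf, hp], hF⟩
    · rintro ⟨k, l, j, F, hj, hF⟩
      have : j = i := by
        cases k with
        | zero => simp [prefixOf] at hj
        | succ k => simpa [prefixOf, List.range_succ_eq_map, hp, eq_comm] using hj
      exact ⟨l, F, this ▸ hF⟩

theorem isPi02_openNat_iff {S : Set (Set ℕ)} : IsPi02 openNat S ↔
    ∃ R Q : ℕ → List ℕ → Prop, REPred (fun x : ℕ × List ℕ => R x.1 x.2) ∧
      REPred (fun x : ℕ × List ℕ => Q x.1 x.2) ∧
      ∀ A, A ∈ S ↔ ∀ i, Covers (R i) A → Covers (Q i) A := by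
  constructor
  · rintro ⟨U, V, hU, hV, h⟩
    obtain ⟨R, hR, hR'⟩ := hU.exists_covers
    obtain ⟨Q, hQ, hQ'⟩ := hV.exists_covers
    exact ⟨R, Q, hR, hQ, fun A => by simp only [h, hR', hQ']⟩
  · rintro ⟨R, Q, hR, hQ, h⟩
    obtain ⟨U, hU, hU'⟩ := exists_openSet_covers hR
    obtain ⟨V, hV, hV'⟩ := exists_openSet_covers hQ
    exact ⟨U, V, hU, hV, fun A => by simp only [h, hU', hV']⟩

/-- A number that decodes to no index contributes a vacuous condition. -/
theorem isPi02_of_covers {α : Type*} [Primcodable α] {S : Set (Set ℕ)} {R Q : α → List ℕ → Prop}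
    (hR : REPred fun x : α × List ℕ => R x.1 x.2) (hQ : REPred fun x : α × List ℕ => Q x.1 x.2)
    (h : ∀ A, A ∈ S ↔ ∀ i, Covers (R i) A → Covers (Q i) A) : IsPi02 openNat S := by
  have key : ∀ T : α → List ℕ → Prop, REPred (fun x : α × List ℕ => T x.1 x.2) →
      REPred fun x : ℕ × List ℕ => ∃ a, decode (α := α) x.1 = some a ∧ T a x.2 := by
    intro T hT
    refine REPred.exists (REPred.and (PrimrecPred.to_re ?_) ?_)
    · exact Primrec.eq.comp (Primrec.decode.comp (Primrec.fst.comp Primrec.fst))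
        (Primrec.option_some.comp Primrec.snd)
    · exact hT.comp (f := fun y : (ℕ × List ℕ) × α => (y.2, y.1.2))
        (Computable.snd.pair (Computable.snd.comp Computable.fst))
  refine isPi02_openNat_iff.2 ⟨fun i F => ∃ a, decode (α := α) i = some a ∧ R a F,
    fun i F => ∃ a, decode (α := α) i = some a ∧ Q a F, key R hR, key Q hQ,
    fun A => (h A).trans ⟨?_, ?_⟩⟩
  · rintro H i ⟨F, ⟨a, ha, hF⟩, hFA⟩
    obtain ⟨G, hG, hGA⟩ := H a ⟨F, hF, hFA⟩
    exact ⟨G, ⟨a, ha, hG⟩, hGA⟩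
  · rintro H a ⟨F, hF, hFA⟩
    obtain ⟨G, ⟨b, hb, hG⟩, hGA⟩ := H (encode a) ⟨F, ⟨a, encodek a, hF⟩, hFA⟩
    rw [encodek, Option.some.injEq] at hb
    exact ⟨G, hb ▸ hG, hGA⟩

theorem IsPi02.inter {S T : Set (Set ℕ)} (hS : IsPi02 openNat S) (hT : IsPi02 openNat T) :
    IsPi02 openNat (S ∩ T) := by
  obtain ⟨R, Q, hR, hQ, h⟩ := isPi02_openNat_iff.1 hS
  obtain ⟨R', Q', hR', hQ', h'⟩ := isPi02_openNat_iff.1 hT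
  have key : ∀ P P' : ℕ → List ℕ → Prop, REPred (fun x : ℕ × List ℕ => P x.1 x.2) →
      REPred (fun x : ℕ × List ℕ => P' x.1 x.2) →
      REPred fun x : (ℕ × ℕ) × List ℕ => (x.1.1 = 0 ∧ P x.1.2 x.2) ∨ (x.1.1 ≠ 0 ∧ P' x.1.2 x.2) := by
    intro P P' hP hP'
    have h0 : PrimrecPred fun x : (ℕ × ℕ) × List ℕ => x.1.1 = 0 :=
      Primrec.eq.comp (Primrec.fst.comp Primrec.fst) (Primrec.const 0)
    have hf : Computable fun x : (ℕ × ℕ) × List ℕ => (x.1.2, x.2) :=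
      (Computable.snd.comp Computable.fst).pair Computable.snd
    exact (h0.to_re.and (hP.comp hf)).or (h0.not.to_re.and (hP'.comp hf))
  refine isPi02_of_covers (R := fun (x : ℕ × ℕ) F => (x.1 = 0 ∧ R x.2 F) ∨ (x.1 ≠ 0 ∧ R' x.2 F))
    (Q := fun (x : ℕ × ℕ) F => (x.1 = 0 ∧ Q x.2 F) ∨ (x.1 ≠ 0 ∧ Q' x.2 F))
    (key R R' hR hR') (key Q Q' hQ hQ') fun A => ?_
  rw [Set.mem_inter_iff, h, h']
  constructor
  · rintro ⟨h1, h2⟩ ⟨a, i⟩ hA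
    rcases Nat.eq_zero_or_pos a with rfl | ha
    · simpa using h1 i (by simpa using hA)
    · simpa [ha.ne'] using h2 i (by simpa [ha.ne'] using hA)
  · intro H
    exact ⟨fun i hA => by simpa using H (0, i) (by simpa using hA),
      fun i hA => by simpa using H (1, i) (by simpa using hA)⟩

end OpenNat

/-! ### Rounded ideals and Π⁰₂ subsets of O(ℕ). -/

section RoundedIdeals

/-- The sets shown below to be Π⁰₂ in O(ℕ) are intersections of such clauses: finitely many members
of A call for one more member. -/
theorem isPi02_clause {α β : Type*} [Primcodable α] [Primcodable β] {K : α → Prop}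
    {f : α → List ℕ} {L : α → β → Prop} {g : α → β → ℕ} (hK : REPred K) (hf : Computable f)
    (hL : REPred fun x : α × β => L x.1 x.2) (hg : Computable fun x : α × β => g x.1 x.2) :
    IsPi02 openNat {A : Set ℕ | ∀ a, K a → (∀ n ∈ f a, n ∈ A) → ∃ b, L a b ∧ g a b ∈ A} := by
  have heq : REPred fun x : List ℕ × List ℕ => x.1 = x.2 := PrimrecPred.to_re Primrec.eq
  refine isPi02_of_covers (R := fun a F => F = f a ∧ K a) (Q := fun a F => ∃ b, F = [g a b] ∧ L a b)
    (REPred.and ?_ (hK.comp Computable.fst)) (REPred.exists (REPred.and ?_ ?_)) fun A => ?_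
  · exact heq.comp (Computable.snd.pair (hf.comp Computable.fst))
  · refine heq.comp (f := fun x : (α × List ℕ) × β => (x.1.2, [g x.1.1 x.2])) ?_
    exact (Computable.snd.comp Computable.fst).pair (Computable.list_cons.comp
      (hg.comp ((Computable.fst.comp Computable.fst).pair Computable.snd)) (Computable.const []))
  · exact hL.comp (f := fun x : (α × List ℕ) × β => (x.1.1, x.2))
      ((Computable.fst.comp Computable.fst).pair Computable.snd)
  · constructor
    · rintro H a ⟨F, ⟨rfl, hK⟩, hF⟩
      obtain ⟨b, hb, hA⟩ := H a hK hF
      exact ⟨_, ⟨b, rfl, hb⟩, by simpa using hA⟩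
    · intro H a hK hF
      obtain ⟨_, ⟨b, rfl, hb⟩, hA⟩ := H a ⟨_, ⟨rfl, hK⟩, hF⟩
      exact ⟨b, hb, by simpa using hA⟩

theorem rePred_true {α : Type*} [Primcodable α] : REPred fun _ : α => True :=
  PrimrecPred.to_re ((Primrec.eq.comp (Primrec.const 0) (Primrec.const 0)).of_eq fun _ => by simp)

theorem isPi02_nonempty : IsPi02 openNat {A : Set ℕ | A.Nonempty} := by
  convert! isPi02_clause (K := fun _ : Unit => True) (f := fun _ => [])
    (L := fun _ _ => True) (g := fun _ n => n) rePred_true (Computable.const [])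
    rePred_true Computable.snd using 1
  ext A
  simp [Set.Nonempty]

theorem isPi02_roundedIdeals {r : ℕ → ℕ → Prop} (hr : REPred fun a : ℕ × ℕ => r a.1 a.2) :
    IsPi02 openNat {I | IsRoundedIdeal r I} := by
  have hlower := isPi02_clause (K := fun x : ℕ × ℕ => r x.1 x.2) (f := fun x => [x.2])
    (L := fun _ (_ : Unit) => True) (g := fun x _ => x.1) hr
    (Computable.list_cons.comp Computable.snd (Computable.const [])) rePred_true
    (Computable.fst.comp Computable.fst)
  have hdirected := isPi02_clause (K := fun _ : ℕ × ℕ => True) (f := fun x => [x.1, x.2])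
    (L := fun x z => r x.1 z ∧ r x.2 z) (g := fun _ z => z) rePred_true
    (Computable.list_cons.comp Computable.fst
      (Computable.list_cons.comp Computable.snd (Computable.const [])))
    ((hr.comp ((Computable.fst.comp Computable.fst).pair Computable.snd)).and
      (hr.comp ((Computable.snd.comp Computable.fst).pair Computable.snd))) Computable.snd
  convert! (isPi02_nonempty.inter hlower).inter hdirected using 1
  ext I
  constructor
  · rintro ⟨a, b, c⟩
    refine ⟨⟨a, fun x hx hI => ⟨(), trivial, b _ _ (hI _ (by simp)) hx⟩⟩, fun x _ hI => ?_⟩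
    obtain ⟨z, hz, h⟩ := c x.1 x.2 (hI _ (by simp)) (hI _ (by simp))
    exact ⟨z, h, hz⟩
  · rintro ⟨⟨a, b⟩, c⟩
    refine ⟨a, fun x y hy hxy => ?_, fun x y hx hy => ?_⟩
    · obtain ⟨-, -, h⟩ := b (x, y) hxy (by simpa using hy)
      exact h
    · obtain ⟨z, h, hz⟩ := c (x, y) trivial (by simp [hx, hy])
      exact ⟨z, hz, h⟩

/-- The decoding of a natural number to an index, a finite set and a stage. -/
def decodeStage (t : ℕ) : (ℕ × List ℕ) × ℕ := Denumerable.ofNat _ t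

theorem primrec_decodeStage : Primrec decodeStage := Primrec.ofNat _

/-- The relation on pairs of a finite set `F` and a stage `n` whose rounded ideals are given by the
sets that satisfy the conditions `Covers (R i) A → Covers (Q i) A`. The relation `P` describes
`R` by stages. -/
def Refines (P : ℕ × List ℕ → ℕ → Prop) (Q : ℕ → List ℕ → Prop) (x y : List ℕ × ℕ) : Prop :=
  (∀ z ∈ x.1, z ∈ y.1) ∧ x.2 < y.2 ∧ ∀ t < x.2,
    ¬ (P (decodeStage t).1 (decodeStage t).2 ∧ ∀ z ∈ (decodeStage t).1.2, z ∈ x.1) ∨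
      ∃ v, Q (decodeStage t).1.1 v ∧ ∀ z ∈ v, z ∈ y.1

/-- The negated part is decidable, since `P` is a primitive recursive stage and the sets are finite.
The bound on `t` leaves only finitely many conditions to check. -/
theorem rePred_refines {P : ℕ × List ℕ → ℕ → Prop} {Q : ℕ → List ℕ → Prop} (hP : PrimrecRel P)
    (hQ : REPred fun x : ℕ × List ℕ => Q x.1 x.2) :
    REPred fun x : (List ℕ × ℕ) × (List ℕ × ℕ) => Refines P Q x.1 x.2 := by
  have hsub : PrimrecRel fun F G : List ℕ => ∀ z ∈ F, z ∈ G := primrecRel_mem.forall_mem_list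
  have hc : Primrec fun y : ((List ℕ × ℕ) × (List ℕ × ℕ)) × ℕ =>
      decodeStage y.2 := primrec_decodeStage.comp Primrec.snd
  unfold Refines
  refine REPred.and (PrimrecPred.to_re ?_) (REPred.and (PrimrecPred.to_re ?_)
    (REPred.forall_lt ?_ (Computable.snd.comp Computable.fst)))
  · exact hsub.comp (Primrec.fst.comp Primrec.fst) (Primrec.fst.comp Primrec.snd)
  · exact Primrec.nat_lt.comp (Primrec.snd.comp Primrec.fst) (Primrec.snd.comp Primrec.snd)
  refine REPred.or (PrimrecPred.to_re ?_) (REPred.exists (REPred.and ?_ (PrimrecPred.to_re ?_)))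
  · refine PrimrecPred.not (PrimrecPred.and ?_ ?_)
    · exact hP.comp (Primrec.fst.comp hc) (Primrec.snd.comp hc)
    · exact hsub.comp (Primrec.snd.comp (Primrec.fst.comp hc))
        (Primrec.fst.comp (Primrec.fst.comp Primrec.fst))
  · exact hQ.comp (f := fun y : (((List ℕ × ℕ) × (List ℕ × ℕ)) × ℕ) × List ℕ =>
      ((decodeStage y.1.2).1.1, y.2))
      (Primrec.to_comp ((Primrec.fst.comp (Primrec.fst.comp (hc.comp Primrec.fst))).pair
        Primrec.snd))
  · exact hsub.comp Primrec.snd (Primrec.fst.comp (Primrec.snd.comp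
      (Primrec.fst.comp Primrec.fst)))

theorem Refines.trans {P : ℕ × List ℕ → ℕ → Prop} {Q : ℕ → List ℕ → Prop}
    {x y z : List ℕ × ℕ} (h : Refines P Q x y) (h' : Refines P Q y z) : Refines P Q x z := by
  refine ⟨fun a ha => h'.1 a (h.1 a ha), h.2.1.trans h'.2.1, fun t ht => ?_⟩
  exact (h.2.2 t ht).imp id fun ⟨v, hv, hv'⟩ => ⟨v, hv, fun a ha => h'.1 a (hv' a ha)⟩

/-- Directedness gathers the finitely many members of `L`. Applied to an element and itself, it
gives an element of later stage, so that `N` is reached. -/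
theorem exists_mem_roundedIdeal {r : ℕ → ℕ → Prop} {D : ℕ → List ℕ × ℕ} {I : Set ℕ}
    (hI : IsRoundedIdeal r I)
    (hr : ∀ a b, r a b → (∀ z ∈ (D a).1, z ∈ (D b).1) ∧ (D a).2 < (D b).2) (N : ℕ) {L : List ℕ}
    (hL : ∀ z ∈ L, ∃ a ∈ I, z ∈ (D a).1) :
    ∃ a ∈ I, (∀ z ∈ L, z ∈ (D a).1) ∧ N ≤ (D a).2 := by
  induction L with
  | nil =>
    induction N with
    | zero =>
      obtain ⟨a, ha⟩ := hI.nonempty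
      exact ⟨a, ha, by simp, Nat.zero_le _⟩
    | succ N ih =>
      obtain ⟨a, ha, -, hN⟩ := ih
      obtain ⟨b, hb, hab, -⟩ := hI.directed a a ha ha
      exact ⟨b, hb, by simp, by have := (hr a b hab).2; omega⟩
  | cons x L ih =>
    obtain ⟨a, ha, hLa, hN⟩ := ih fun z hz => hL z (List.mem_cons_of_mem _ hz)
    obtain ⟨b, hb, hxb⟩ := hL x List.mem_cons_self
    obtain ⟨c, hc, hac, hbc⟩ := hI.directed a b ha hb
    refine ⟨c, hc, fun z hz => ?_, hN.trans (hr a c hac).2.le⟩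
    rcases List.mem_cons.1 hz with rfl | hz
    · exact (hr b c hbc).1 _ hxb
    · exact (hr a c hac).1 _ (hLa z hz)

theorem exists_computablyIsomorphic_RI {S : Set (Set ℕ)} (hS : IsPi02 openNat S) :
    ∃ r : ℕ → ℕ → Prop, REPred (fun a : ℕ × ℕ => r a.1 a.2) ∧ IsTrans ℕ r ∧
      ComputablyIsomorphic (openNat.subspace S) (RI r) := by
  obtain ⟨R, Q, hR, hQ, hS⟩ := isPi02_openNat_iff.1 hS
  obtain ⟨P, hP, -, hRP⟩ := hR.exists_stages
  let D : ℕ → List ℕ × ℕ := Denumerable.ofNat (List ℕ × ℕ)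
  have hD : Primrec D := Primrec.ofNat _
  have hDsurj : ∀ x, ∃ a, D a = x := fun x => ⟨encode x, Denumerable.ofNat_encode x⟩
  let r : ℕ → ℕ → Prop := fun a b => Refines P Q (D a) (D b)
  have hrD : ∀ a b, r a b → (∀ z ∈ (D a).1, z ∈ (D b).1) ∧ (D a).2 < (D b).2 :=
    fun a b h => ⟨h.1, h.2.1⟩
  let toIdeal : Set ℕ → Set ℕ := fun A => {a | ∀ z ∈ (D a).1, z ∈ A}
  let ofIdeal : Set ℕ → Set ℕ := fun I => {z | ∃ a ∈ I, z ∈ (D a).1}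
  have h_of_to : ∀ A, ofIdeal (toIdeal A) = A := by
    intro A
    ext z
    constructor
    · rintro ⟨a, ha, hz⟩
      exact ha z hz
    · intro hz
      obtain ⟨a, ha⟩ := hDsurj ([z], 0)
      exact ⟨a, by simpa [toIdeal, ha] using hz, by simp [ha]⟩
  have h_to : ∀ A ∈ S, IsRoundedIdeal r (toIdeal A) := by
    intro A hA
    -- Fewer than `n` conditions need attention; each one triggered by `F` is met by a finite subset
    -- of `A`, as `A ∈ S`. `G` collects these subsets.
    have key : ∀ (F : List ℕ) (n : ℕ), (∀ z ∈ F, z ∈ A) → ∃ G : List ℕ, (∀ z ∈ G, z ∈ A) ∧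
        ∀ t < n, ¬ (P (decodeStage t).1 (decodeStage t).2 ∧ ∀ z ∈ (decodeStage t).1.2, z ∈ F) ∨
          ∃ v, Q (decodeStage t).1.1 v ∧ ∀ z ∈ v, z ∈ G := by
      intro F n hF
      induction n with
      | zero => exact ⟨[], by simp, by simp⟩
      | succ n ih =>
        obtain ⟨G, hG, h⟩ := ih
        by_cases hc : P (decodeStage n).1 (decodeStage n).2 ∧ ∀ z ∈ (decodeStage n).1.2, z ∈ F
        · obtain ⟨v, hv, hvA⟩ := (hS A).1 hA (decodeStage n).1.1
            ⟨_, (hRP (decodeStage n).1).2 ⟨_, hc.1⟩, fun z hz => hF z (hc.2 z hz)⟩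
          refine ⟨G ++ v, fun z hz => (List.mem_append.1 hz).elim (hG z) (hvA z), fun t ht => ?_⟩
          rcases Nat.lt_succ_iff_lt_or_eq.1 ht with ht | rfl
          · exact (h t ht).imp id fun ⟨w, hw, hwG⟩ =>
              ⟨w, hw, fun z hz => List.mem_append_left _ (hwG z hz)⟩
          · exact Or.inr ⟨v, hv, fun z hz => List.mem_append_right _ hz⟩
        · refine ⟨G, hG, fun t ht => ?_⟩
          rcases Nat.lt_succ_iff_lt_or_eq.1 ht with ht | rfl
          · exact h t ht
          · exact Or.inl hc
    refine ⟨?_, ?_, ?_⟩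
    · obtain ⟨a, ha⟩ := hDsurj ([], 0)
      exact ⟨a, by simp [toIdeal, ha]⟩
    · exact fun a b hb hab z hz => hb z (hab.1 z hz)
    · intro a b ha hb
      obtain ⟨G, hG, hGa⟩ := key _ (D a).2 ha
      obtain ⟨G', hG', hGb⟩ := key _ (D b).2 hb
      -- An upper bound of both: it includes the two finite sets and the witnesses for their
      -- conditions, at a stage beyond both.
      obtain ⟨c, hc⟩ := hDsurj ((D a).1 ++ (D b).1 ++ (G ++ G'), (D a).2 + (D b).2 + 1)
      refine ⟨c, ?_, ⟨?_, ?_, fun t ht => ?_⟩, ⟨?_, ?_, fun t ht => ?_⟩⟩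
      · intro z hz
        simp only [hc, List.mem_append] at hz
        rcases hz with (hz | hz) | hz | hz
        · exact ha z hz
        · exact hb z hz
        · exact hG z hz
        · exact hG' z hz
      · intro z hz
        simp [hc, hz]
      · simp only [hc]
        omega
      · exact (hGa t ht).imp id fun ⟨v, hv, hvG⟩ => ⟨v, hv, fun z hz => by simp [hc, hvG z hz]⟩
      · intro z hz
        simp [hc, hz]
      · simp only [hc]
        omega
      · exact (hGb t ht).imp id fun ⟨v, hv, hvG⟩ => ⟨v, hv, fun z hz => by simp [hc, hvG z hz]⟩
  have h_of : ∀ I, IsRoundedIdeal r I → ofIdeal I ∈ S := by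
    intro I hI
    refine (hS _).2 fun i ⟨F, hF, hFI⟩ => ?_
    obtain ⟨k, hk⟩ := (hRP (i, F)).1 hF
    -- The stage of `a` exceeds the code of this condition, so any element above `a` must meet it.
    obtain ⟨a, ha, hFa, hN⟩ := exists_mem_roundedIdeal hI hrD (encode ((i, F), k) + 1) hFI
    obtain ⟨b, hb, hab, -⟩ := hI.directed a a ha ha
    have hdec : decodeStage (encode ((i, F), k)) = ((i, F), k) := Denumerable.ofNat_encode _
    have := hab.2.2 (encode ((i, F), k)) hN
    rw [hdec] at this
    obtain ⟨v, hv, hvb⟩ := this.resolve_left (not_not_intro ⟨hk, hFa⟩)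
    exact ⟨v, hv, fun z hz => ⟨b, hb, hvb z hz⟩⟩
  have h_to_of : ∀ I, IsRoundedIdeal r I → toIdeal (ofIdeal I) = I := by
    intro I hI
    ext a
    constructor
    · intro ha
      -- `b` dominates `a` in set and stage, so all that `a` demands is demanded by `b` and met by
      -- `c`. Thus `a` is below `c`, and lower closure applies.
      obtain ⟨b, hb, hab, hN⟩ := exists_mem_roundedIdeal hI hrD (D a).2 ha
      obtain ⟨c, hc, hbc, -⟩ := hI.directed b b hb hb
      refine hI.lower a c hc ⟨fun z hz => hbc.1 z (hab z hz), hN.trans_lt hbc.2.1, fun t ht => ?_⟩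
      exact (hbc.2.2 t (ht.trans_le hN)).imp
        (fun h h' => h ⟨h'.1, fun z hz => hab z (h'.2 z hz)⟩) id
    · exact fun ha z hz => ⟨a, ha, hz⟩
  refine ⟨r, ?_, ⟨fun a b c => Refines.trans⟩,
    ⟨fun A => ⟨toIdeal A, h_to A A.2⟩, fun I => ⟨ofIdeal I, h_of I I.2⟩,
      fun A => Subtype.ext (h_of_to A), fun I => Subtype.ext (h_to_of I I.2)⟩, ?_, ?_⟩
  · exact (rePred_refines hP hQ).comp (f := fun a : ℕ × ℕ => (D a.1, D a.2))
      (Primrec.to_comp ((hD.comp Primrec.fst).pair (hD.comp Primrec.snd)))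
  · refine isComputable_openNat (γ := openNat.subspace S) (f := fun A => toIdeal A)
      (H := fun w a => ∀ z ∈ (D a).1, z + 1 ∈ w) (PrimrecPred.to_re ?_) ?_
    · have : PrimrecRel fun (n : ℕ) (w : List ℕ) => n + 1 ∈ w :=
        primrecRel_mem.comp (Primrec.succ.comp Primrec.fst) Primrec.snd
      exact this.forall_mem_list.comp (Primrec.fst.comp (hD.comp Primrec.snd)) Primrec.fst
    · intro p A hp a
      exact ⟨fun h => exists_prefix_of_subset hp h,
        fun ⟨k, hk⟩ z hz => mem_of_mem_prefixOf hp (hk z hz)⟩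
  · refine isComputable_openNat (γ := RI r) (f := fun I => ofIdeal I)
      (H := fun w z => ∃ a ∈ w, a ≠ 0 ∧ z ∈ (D a.pred).1) (PrimrecPred.to_re ?_) ?_
    · have : PrimrecRel fun (a z : ℕ) => a ≠ 0 ∧ z ∈ (D a.pred).1 :=
        (Primrec.eq.comp Primrec.fst (Primrec.const 0)).not.and
          (primrecRel_mem.comp Primrec.snd
            (Primrec.fst.comp (hD.comp (Primrec.pred.comp Primrec.fst))))
      exact this.exists_mem_list
    · intro p I hp z
      constructor
      · rintro ⟨a, ha, hz⟩
        obtain ⟨k, hk⟩ := exists_prefix_of_subset (F := [a]) hp (by simpa using ha)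
        exact ⟨k, a + 1, hk a (by simp), by simp, hz⟩
      · rintro ⟨k, a, ha, h0, hz⟩
        obtain ⟨b, rfl⟩ := Nat.exists_eq_succ_of_ne_zero h0
        exact ⟨b, mem_of_mem_prefixOf hp ha, hz⟩

end RoundedIdeals

end RepSpace

namespace RepSpace

open Encodable

/-! ### Representing points by the enumerations of their sets. -/

section FiberOvert

variable {X : Type u} {δ : Representation X}

theorem exists_prefixOf_eq_of_mem_closure {A : Set Baire} {p : Baire} (h : p ∈ closure A) (k : ℕ) :
    ∃ q ∈ A, prefixOf q k = prefixOf p k := by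
  have ho : IsOpen {q : Baire | ∀ i ∈ Finset.range k, q i = p i} := by
    simp only [Set.ofPred_forall]
    refine isOpen_biInter_finset fun i _ => ?_
    exact (isOpen_discrete ({p i} : Set ℕ)).preimage (f := fun q : Baire => q i)
      (continuous_apply i)
  obtain ⟨q, hq, hqA⟩ := mem_closure_iff.1 h _ ho fun i _ => rfl
  exact ⟨q, hqA, prefixOf_eq_iff.2 fun i hi => hq i (Finset.mem_range.2 hi)⟩

/-- An open set meets the closure of A iff it meets A. -/
theorem mem_overt_iff {A : Set Baire} {c : Baire} {U : OpenSet baire}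
    (hc : (openSpace baire).IsName c U) :
    U ∈ (overt baire (closure A)).1 ↔
      ∃ k, ∃ p ∈ A, ∃ l, Accepts (prefixOf c k) (prefixOf p l) := by
  constructor
  · rintro ⟨p, hp, hpU⟩
    obtain ⟨k, l, h⟩ := (accepts_iff (δ := baire) hc rfl).1 hpU
    obtain ⟨q, hq, hqp⟩ := exists_prefixOf_eq_of_mem_closure hp l
    exact ⟨k, q, hq, l, hqp ▸ h⟩
  · rintro ⟨k, p, hp, l, h⟩
    exact ⟨p, subset_closure hp, (accepts_iff (δ := baire) hc rfl).2 ⟨k, l, h⟩⟩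

/-- The representation of a subspace of the space of subsets of `ℕ` along a bijection. -/
def pullback {S : Set (Set ℕ)} (e : X ≃ S) : Representation X where
  IsName p x := openNat.IsName p (e x)
  unique h h' := e.injective (Subtype.ext (openNat.unique h h'))
  surj _ := openNat.surj _

/-- A word begins a name of x iff it lists only members of `e x`, and any name of x lets one
enumerate these words. -/
theorem effectivelyFiberOvert_pullback {S : Set (Set ℕ)} (e : X ≃ S) :
    EffectivelyFiberOvert (pullback e) := by
  refine isComputable_openSpace (δ := openSpace baire)
    (f := fun x => (overt baire (closure {p | (pullback e).IsName p x})).1)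
    (H := fun s c => ∃ w, Accepts c w ∧ ∀ a ∈ w, a = 0 ∨ a ∈ s) ?_ fun p x c U hp hc => ?_
  · refine REPred.exists (REPred.and ?_ (PrimrecPred.to_re ?_))
    · exact rePred_accepts.comp (f := fun y : (List ℕ × List ℕ) × List ℕ => (y.1.2, y.2))
        ((Computable.snd.comp Computable.fst).pair Computable.snd)
    · have : PrimrecRel fun (a : ℕ) (s : List ℕ) => a = 0 ∨ a ∈ s :=
        PrimrecPred.or (Primrec.eq.comp Primrec.fst (Primrec.const 0)) primrecRel_mem
      exact this.forall_mem_list.comp Primrec.snd (Primrec.fst.comp Primrec.fst)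
  · have hp : openNat.IsName p (e x) := hp
    rw [mem_overt_iff hc]
    constructor
    · rintro ⟨k, q, hq, l, h⟩
      have hq : openNat.IsName q (e x) := hq
      obtain ⟨m, hm⟩ := exists_prefix_of_subset hp
        (F := ((prefixOf q l).filter (· ≠ 0)).map Nat.pred) fun n hn => by
          obtain ⟨a, ha, rfl⟩ := List.mem_map.1 hn
          obtain ⟨ha, h0⟩ := List.mem_filter.1 ha
          have h0 : a ≠ 0 := by simpa using h0
          exact mem_of_mem_prefixOf hq (by rwa [← Nat.succ_eq_add_one, Nat.succ_pred h0])
      refine ⟨m, k, _, h, fun a ha => ?_⟩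
      by_cases h0 : a = 0
      · exact Or.inl h0
      · right
        have := hm _ (List.mem_map.2 ⟨a, List.mem_filter.2 ⟨ha, by simpa using h0⟩, rfl⟩)
        rwa [← Nat.succ_eq_add_one, Nat.succ_pred h0] at this
    · rintro ⟨m, k, w, h, hw⟩
      refine ⟨k, append w p, ?_, w.length, by rwa [prefixOf_append]⟩
      exact isName_append hp fun n hn =>
        mem_of_mem_prefixOf hp ((hw _ hn).resolve_left (Nat.succ_ne_zero n))

/-- A neighbourhood filter yields an enumeration of `e x` by testing it on the open sets {x | n ∈ e
x}, whose codes are computable from n. -/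
theorem computablyAdmissible_pullback {S : Set (Set ℕ)} (e : X ≃ S) :
    ComputablyAdmissible (pullback e) := by
  have hU : ∀ n, Realizes (pullback e) sierpinski (openCode fun w => n + 1 ∈ w)
      fun x => n ∈ (e x : Set ℕ) := by
    intro n
    refine realizes_openCode fun p x hp => ⟨fun h => ?_, ?_⟩
    · obtain ⟨k, hk⟩ := exists_prefix_of_subset (F := [n]) hp (by simpa using h)
      exact ⟨k, hk n (by simp)⟩
    · rintro ⟨k, hk⟩
      exact mem_of_mem_prefixOf hp hk
  let U : ℕ → OpenSet (pullback e) := fun n => ⟨fun x => n ∈ (e x : Set ℕ), _, hU n⟩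
  have hinj : Function.Injective (nbhds (pullback e)) := by
    intro x y hxy
    apply e.injective
    ext n
    have : U n ∈ nbhds (pullback e) x ↔ U n ∈ nbhds (pullback e) y := by rw [hxy]
    exact this
  let e' := Equiv.ofInjective _ hinj
  refine ⟨e', fun x => rfl, isComputable_nbhds _, ?_⟩
  refine isComputable_openNat (γ := (openSpace (openSpace (pullback e))).subspace _)
    (f := fun y => (e (e'.symm y) : Set ℕ))
    (H := fun s n => ∃ k, Accepts s (prefixOf (openCode fun w => n + 1 ∈ w) k)) ?_ ?_
  · have h1 : PrimrecRel fun (n : ℕ) (w : List ℕ) => n + 1 ∈ w :=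
      primrecRel_mem.comp (Primrec.succ.comp Primrec.fst) Primrec.snd
    refine REPred.exists (rePred_accepts.comp (f := fun y : (List ℕ × ℕ) × ℕ =>
      (y.1.1, prefixOf (openCode fun w => y.1.2 + 1 ∈ w) y.2)) ?_)
    exact (Computable.fst.comp Computable.fst).pair
      ((primrec_prefixOf (primrec_openCode h1)).comp
        (Primrec.snd.comp Primrec.fst) Primrec.snd).to_comp
  · rintro c y hc n
    obtain ⟨x, rfl⟩ := e'.surjective y
    have hc : (openSpace (openSpace (pullback e))).IsName c (nbhds (pullback e) x) := hc
    have := accepts_iff (δ := openSpace (pullback e)) (x := U n) hc (hU n)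
    rw [← this, e'.symm_apply_apply]
    rfl

/-- Every sequence p enumerates some set `A p`, so the domain is the preimage of S under `A`. A code
of an open subset of O(ℕ) is also a code of its preimage. -/
theorem isPi02_dom_pullback {S : Set (Set ℕ)} (hS : IsPi02 openNat S) (e : X ≃ S) :
    IsPi02 baire (pullback e).dom := by
  obtain ⟨U, V, ⟨q, hq, hU⟩, ⟨q', hq', hV⟩, h⟩ := hS
  let A : Baire → Set ℕ := fun p => {n | ∃ i, p i = n + 1}
  have key : ∀ (W : OpenSet openNat) c, Realizes openNat sierpinski c W.1 →
      Realizes baire sierpinski c fun p => A p ∈ W := by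
    rintro W c hc p x rfl
    exact hc p (A p) rfl
  let T : OpenSet openNat → OpenSet baire := fun W =>
    ⟨fun p => A p ∈ W, W.2.imp (key W)⟩
  refine ⟨fun n => T (U n), fun n => T (V n), ⟨q, hq, ?_⟩, ⟨q', hq', ?_⟩, fun p => ?_⟩
  · intro p n hp
    obtain ⟨r, hr, hr'⟩ := hU p n hp
    exact ⟨r, hr, key _ _ hr'⟩
  · intro p n hp
    obtain ⟨r, hr, hr'⟩ := hV p n hp
    exact ⟨r, hr, key _ _ hr'⟩
  · refine Iff.trans ⟨?_, ?_⟩ (h (A p))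
    · rintro ⟨x, hx⟩
      rw [← show _ = A p from hx]
      exact (e x).2
    · intro hA
      refine ⟨e.symm ⟨A p, hA⟩, ?_⟩
      change openNat.IsName p (e (e.symm ⟨A p, hA⟩))
      rw [e.apply_symm_apply]
      rfl

theorem computablyEquivalent_pullback {δ : Representation X} {S : Set (Set ℕ)} {e : X ≃ S}
    (h : IsComputable δ (openNat.subspace S) e) (h' : IsComputable (openNat.subspace S) δ e.symm) :
    ComputablyEquivalent (pullback e) δ := by
  obtain ⟨q, hq, hq'⟩ := h'
  refine ⟨⟨q, hq, fun p x hp => ?_⟩, h⟩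
  simpa using hq' p (e x) hp

end FiberOvert

/-! ### Embedding a space into O(ℕ) by prefixes of names. -/

section Image

variable {X : Type u} {δ : Representation X}

/-- The set of codes of the prefixes of names of `x`. -/
def namePrefixes (δ : Representation X) (x : X) : Set ℕ :=
  {n | ∃ p, δ.IsName p x ∧ prefixOf p (Denumerable.ofNat (List ℕ) n).length = Denumerable.ofNat _ n}

theorem encode_mem_namePrefixes {x : X} {w : List ℕ} :
    encode w ∈ namePrefixes δ x ↔ ∃ p, δ.IsName p x ∧ prefixOf p w.length = w := by
  simp [namePrefixes]

theorem encode_prefixOf_mem {x : X} {p : Baire} (hp : δ.IsName p x) (k : ℕ) :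
    encode (prefixOf p k) ∈ namePrefixes δ x :=
  encode_mem_namePrefixes.2 ⟨p, hp, by simp⟩

theorem mem_iff_exists_namePrefixes {c : Baire} {U : OpenSet δ} (hc : (openSpace δ).IsName c U)
    {x : X} : x ∈ U ↔ ∃ k w, encode w ∈ namePrefixes δ x ∧ Accepts (prefixOf c k) w := by
  constructor
  · intro hx
    obtain ⟨p, hp⟩ := δ.surj x
    obtain ⟨k, l, h⟩ := (accepts_iff hc hp).1 hx
    exact ⟨k, _, encode_prefixOf_mem hp l, h⟩
  · rintro ⟨k, w, hw, h⟩
    obtain ⟨p, hp, hpw⟩ := encode_mem_namePrefixes.1 hw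
    exact (accepts_iff hc hp).2 ⟨k, w.length, by rwa [hpw]⟩

/-- A word begins a name of x iff its cylinder meets the fiber of x, and a code of the cylinder is
computable from the word. -/
theorem EffectivelyFiberOvert.exists_rePred (h : EffectivelyFiberOvert δ) :
    ∃ Φ : List ℕ → List ℕ → Prop, REPred (fun x : List ℕ × List ℕ => Φ x.1 x.2) ∧
      (∀ s t w, s <+: t → Φ s w → Φ t w) ∧
      ∀ p x, δ.IsName p x → ∀ w, encode w ∈ namePrefixes δ x ↔ ∃ k, Φ (prefixOf p k) w := by
  have hf : IsComputable δ (openSpace (openSpace baire)) fun x =>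
    (overt baire (closure {p | δ.IsName p x})).1 := h
  obtain ⟨H, hH, hmono, hH'⟩ := hf.exists_rePred
  refine ⟨fun s w => ∃ l, H s (prefixOf (openCode fun v => w <+: v) l), ?_, ?_, ?_⟩
  · refine REPred.exists (hH.comp (f := fun y : (List ℕ × List ℕ) × ℕ =>
      (y.1.1, prefixOf (openCode fun v => y.1.2 <+: v) y.2)) ?_)
    exact (Computable.fst.comp Computable.fst).pair
      ((primrec_prefixOf (primrec_openCode primrecRel_prefix)).comp
        (Primrec.snd.comp Primrec.fst) Primrec.snd).to_comp
  · rintro s t w hst ⟨l, hl⟩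
    exact ⟨l, hmono _ _ _ _ hst List.prefix_rfl hl⟩
  · intro p x hp w
    have hc : Realizes baire sierpinski (openCode fun v => w <+: v)
        fun p => prefixOf p w.length = w := by
      refine realizes_openCode ?_
      rintro p _ rfl
      constructor
      · exact fun h => ⟨w.length, by rw [h]⟩
      · rintro ⟨k, hk⟩
        exact prefixOf_length_of_prefix hk
    refine Iff.trans ?_ (hH' p x _ ⟨_, _, hc⟩ hp hc)
    rw [encode_mem_namePrefixes]
    constructor
    · rintro ⟨p, hp, hpw⟩
      exact ⟨p, subset_closure hp, hpw⟩
    · rintro ⟨p, hp, hpw⟩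
      obtain ⟨q, hq, hqp⟩ := exists_prefixOf_eq_of_mem_closure hp w.length
      exact ⟨q, hq, hqp.trans hpw⟩

theorem isComputable_namePrefixes (h : EffectivelyFiberOvert δ) :
    IsComputable δ openNat (namePrefixes δ) := by
  obtain ⟨Φ, hΦ, -, hΦ'⟩ := h.exists_rePred
  refine isComputable_openNat (H := fun s n => Φ s (Denumerable.ofNat (List ℕ) n)) ?_ ?_
  · exact hΦ.comp (f := fun x : List ℕ × ℕ => (x.1, Denumerable.ofNat (List ℕ) x.2))
      (Computable.fst.pair ((Primrec.ofNat _).to_comp.comp Computable.snd))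
  · intro p x hp n
    rw [← hΦ' p x hp, Denumerable.encode_ofNat]

/-- An open set contains x iff its code accepts some prefix of a name of x. So the prefixes compute
the neighbourhood filter, from which admissibility recovers a name of x. -/
theorem computablyIsomorphic_range_namePrefixes (h : EffectivelyFiberOvert δ)
    (h' : ComputablyAdmissible δ) :
    ComputablyIsomorphic δ (openNat.subspace (Set.range (namePrefixes δ))) := by
  obtain ⟨e, he, -, he'⟩ := h'
  have hinj : Function.Injective (namePrefixes δ) := by
    intro x y hxy
    apply e.injective
    apply Subtype.ext
    rw [he, he]
    apply Subtype.ext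
    funext U
    obtain ⟨c, hc⟩ := (openSpace δ).surj U
    exact propext ((mem_iff_exists_namePrefixes hc).trans
      (hxy ▸ (mem_iff_exists_namePrefixes hc).symm))
  let j := Equiv.ofInjective _ hinj
  refine ⟨j, isComputable_namePrefixes h, ?_⟩
  have hg : IsComputable (openNat.subspace (Set.range (namePrefixes δ)))
      ((openSpace (openSpace δ)).subspace (Set.range (nbhds δ))) fun y => e (j.symm y) := by
    refine isComputable_openSpace (δ := openSpace δ)
      (γ := openNat.subspace (Set.range (namePrefixes δ))) (f := fun y => (e (j.symm y)).1)
      (H := fun s c => ∃ w, encode w + 1 ∈ s ∧ Accepts c w) ?_ ?_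
    · refine REPred.exists (REPred.and (PrimrecPred.to_re ?_) ?_)
      · exact primrecRel_mem.comp (Primrec.succ.comp (Primrec.encode.comp Primrec.snd))
          (Primrec.fst.comp Primrec.fst)
      · exact rePred_accepts.comp (f := fun y : (List ℕ × List ℕ) × List ℕ => (y.1.2, y.2))
          ((Computable.snd.comp Computable.fst).pair Computable.snd)
    · rintro p y c U hp hc
      obtain ⟨x, rfl⟩ := j.surjective y
      have hp : openNat.IsName p (namePrefixes δ x) := hp
      rw [j.symm_apply_apply, he]
      refine (mem_iff_exists_namePrefixes (x := x) hc).trans ⟨?_, ?_⟩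
      · rintro ⟨k, w, hw, hk⟩
        obtain ⟨m, hm⟩ := exists_prefix_of_subset (F := [encode w]) hp (by simpa using hw)
        exact ⟨m, k, w, hm _ (by simp), hk⟩
      · rintro ⟨m, k, w, hw, hk⟩
        exact ⟨k, w, mem_of_mem_prefixOf hp hw, hk⟩
  simpa using he'.comp hg

end Image

end RepSpace

namespace RepSpace

open Encodable

/-! ### The range of the embedding is Π⁰₂. -/

section Range

variable {X : Type u} {δ : Representation X}

theorem exists_sequence_of_prefixes {u : ℕ → List ℕ} (hu : ∀ k, u k <+: u (k + 1))
    (hl : ∀ k, (u k).length < (u (k + 1)).length) : ∃ p, ∀ k, prefixOf p (u k).length = u k := by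
  have hmono : ∀ k l, k ≤ l → u k <+: u l := by
    intro k l hkl
    induction hkl with
    | refl => exact List.prefix_rfl
    | step _ ih => exact ih.trans (hu _)
  have hlen : ∀ k, k ≤ (u k).length := by
    intro k
    induction k with
    | zero => exact Nat.zero_le _
    | succ k ih => exact Nat.succ_le_of_lt (ih.trans_lt (hl k))
  refine ⟨fun i => (u (i + 1)).getD i 0, fun k => List.ext_getElem (by simp) fun i _ hi => ?_⟩
  have hi' : i < (u (i + 1)).length := hlen (i + 1)
  have : (u (i + 1))[i] = (u k)[i] := by
    rcases le_total (i + 1) k with h | h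
    · exact (hmono _ _ h).getElem hi'
    · exact ((hmono _ _ h).getElem hi).symm
  simp [prefixOf, hi', this]

/-- Besides non-emptiness, `hext` makes chains in T grow, `hdense` steers their limits into the
domain, and `hsub` and `hsup` force `Φ` to enumerate exactly T along a suitable chain. -/
theorem isPi02_range_namePrefixes (h : EffectivelyFiberOvert δ) (hdom : IsPi02 baire δ.dom) :
    IsPi02 openNat (Set.range (namePrefixes δ)) := by
  obtain ⟨Φ, hΦ, hΦmono, hΦ'⟩ := h.exists_rePred
  obtain ⟨U, V, hU, hV, hdom⟩ := hdom
  obtain ⟨R, hR, hRmono, hR'⟩ := hU.exists_rePred_nat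
  obtain ⟨Q, hQ, hQmono, hQ'⟩ := hV.exists_rePred_nat
  have hlt : PrimrecRel fun v w : List ℕ => v.length < w.length :=
    Primrec.nat_lt.comp (Primrec.list_length.comp Primrec.fst)
      (Primrec.list_length.comp Primrec.snd)
  have hcode : Computable fun w : List ℕ => [encode w] :=
    Computable.list_cons.comp Computable.encode (Computable.const [])
  have hext := isPi02_clause (K := fun _ : List ℕ => True) (f := fun w => [encode w])
    (L := fun w v => w <+: v ∧ w.length < v.length) (g := fun _ v => encode v) rePred_true hcode
    (primrecRel_prefix.and hlt).to_re (Computable.encode.comp Computable.snd)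
  have hdense := isPi02_clause (K := fun x : ℕ × List ℕ => R x.1 x.2) (f := fun x => [encode x.2])
    (L := fun x v => x.2 <+: v ∧ Q x.1 v) (g := fun _ v => encode v) hR
    (hcode.comp Computable.snd)
    ((primrecRel_prefix.comp (Primrec.snd.comp Primrec.fst) Primrec.snd).to_re.and
      (hQ.comp ((Computable.fst.comp Computable.fst).pair Computable.snd)))
    (Computable.encode.comp Computable.snd)
  have hsub := isPi02_clause (K := fun x : List ℕ × List ℕ => Φ x.1 x.2)
    (f := fun x => [encode x.1]) (L := fun _ (_ : Unit) => True) (g := fun x _ => encode x.2) hΦ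
    (hcode.comp Computable.fst) rePred_true
    (Computable.encode.comp (Computable.snd.comp Computable.fst))
  have hsup := isPi02_clause (K := fun _ : List ℕ × List ℕ => True)
    (f := fun x => [encode x.1, encode x.2]) (L := fun x v => x.1 <+: v ∧ Φ v x.2)
    (g := fun _ v => encode v) rePred_true
    (Computable.list_cons.comp (Computable.encode.comp Computable.fst)
      (hcode.comp Computable.snd))
    ((primrecRel_prefix.comp (Primrec.fst.comp Primrec.fst) Primrec.snd).to_re.and
      (hΦ.comp (Computable.snd.pair (Computable.snd.comp Computable.fst))))
    (Computable.encode.comp Computable.snd)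
  convert! (((isPi02_nonempty.inter hext).inter hdense).inter hsub).inter hsup using 1
  ext T
  constructor
  · rintro ⟨x, rfl⟩
    have hpre : ∀ p, δ.IsName p x → ∀ k l, prefixOf p k <+: prefixOf p (k + l) :=
      fun p _ k l => prefixOf_mono p (Nat.le_add_right k l)
    refine ⟨⟨⟨⟨?_, fun w _ hw => ?_⟩, fun y hy hw => ?_⟩, fun y hy hw => ⟨(), trivial, ?_⟩⟩,
      fun y _ hw => ?_⟩
    · obtain ⟨p, hp⟩ := δ.surj x
      exact ⟨_, encode_prefixOf_mem hp 0⟩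
    · obtain ⟨p, hp, hpw⟩ := encode_mem_namePrefixes.1 (hw _ (List.mem_singleton_self _))
      refine ⟨_, ⟨?_, ?_⟩, encode_prefixOf_mem hp (w.length + 1)⟩
      · conv_lhs => rw [← hpw]
        exact hpre p hp _ _
      · simp
    · obtain ⟨n, w⟩ := y
      obtain ⟨p, hp, hpw⟩ := encode_mem_namePrefixes.1 (hw _ (List.mem_singleton_self _))
      have hpU : p ∈ U n := (hR' n p p rfl).2 ⟨w.length, by rwa [hpw]⟩
      obtain ⟨k, hk⟩ := (hQ' n p p rfl).1 ((hdom p).1 ⟨x, hp⟩ n hpU)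
      refine ⟨_, ⟨?_, ?_⟩, encode_prefixOf_mem hp (w.length + k)⟩
      · conv_lhs => rw [← hpw]
        exact hpre p hp _ _
      · exact hQmono _ _ _ (prefixOf_mono p (Nat.le_add_left k _)) hk
    · obtain ⟨w, v⟩ := y
      obtain ⟨p, hp, hpw⟩ := encode_mem_namePrefixes.1 (hw _ (List.mem_singleton_self _))
      exact (hΦ' p x hp v).2 ⟨w.length, by rwa [hpw]⟩
    · obtain ⟨w, v⟩ := y
      obtain ⟨p, hp, hpw⟩ := encode_mem_namePrefixes.1 (hw (encode w) (by simp))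
      obtain ⟨k, hk⟩ := (hΦ' p x hp v).1 (hw (encode v) (by simp))
      refine ⟨_, ⟨?_, ?_⟩, encode_prefixOf_mem hp (w.length + k)⟩
      · conv_lhs => rw [← hpw]
        exact hpre p hp _ _
      · exact hΦmono _ _ _ (prefixOf_mono p (Nat.le_add_left k _)) hk
  · rintro ⟨⟨⟨⟨hne, hext⟩, hdense⟩, hsub⟩, hsup⟩
    -- One extension deals with every requirement of index `n`. By monotonicity of `R`, it does no
    -- harm to lengthen `w` before its condition is tested.
    have hnext : ∀ n w, encode w ∈ T → ∃ v, encode v ∈ T ∧ w <+: v ∧ w.length < v.length ∧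
        (R n w → Q n v) ∧ (n ∈ T → Φ v (Denumerable.ofNat _ n)) := by
      intro n w hw
      obtain ⟨w₁, ⟨h1, h1'⟩, hw₁⟩ := hext w trivial (by simpa using hw)
      obtain ⟨w₂, hw₂, h2, h2'⟩ : ∃ v, encode v ∈ T ∧ w₁ <+: v ∧ (R n w → Q n v) := by
        by_cases hc : R n w₁
        · obtain ⟨v, ⟨hv, hv'⟩, hvT⟩ := hdense (n, w₁) hc (by simpa using hw₁)
          exact ⟨v, hvT, hv, fun _ => hv'⟩
        · exact ⟨w₁, hw₁, List.prefix_rfl, fun h => absurd (hRmono _ _ _ h1 h) hc⟩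
      obtain ⟨w₃, hw₃, h3, h3'⟩ : ∃ v, encode v ∈ T ∧ w₂ <+: v ∧
          (n ∈ T → Φ v (Denumerable.ofNat _ n)) := by
        by_cases hc : n ∈ T
        · obtain ⟨v, ⟨hv, hv'⟩, hvT⟩ := hsup (w₂, Denumerable.ofNat _ n) trivial
            (by simp [hw₂, hc])
          exact ⟨v, hvT, hv, fun _ => hv'⟩
        · exact ⟨w₂, hw₂, List.prefix_rfl, fun h => absurd h hc⟩
      exact ⟨w₃, hw₃, h1.trans (h2.trans h3), h1'.trans_le (h2.trans h3).length_le,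
        fun h => hQmono _ _ _ h3 (h2' h), h3'⟩
    choose! next hnT hnpre hnlen hnR hnΦ using hnext
    obtain ⟨n₀, hn₀⟩ := hne
    -- Step `k` treats the index `k.unpair.1`, so each index recurs arbitrarily late; this matters
    -- because `R n` may hold only for long prefixes of the limit.
    let u : ℕ → List ℕ := fun k =>
      Nat.rec (Denumerable.ofNat (List ℕ) n₀) (fun k w => next k.unpair.1 w) k
    have huT : ∀ k, encode (u k) ∈ T := by
      intro k
      induction k with
      | zero => simpa [u] using hn₀
      | succ k ih => exact hnT _ _ ih
    have hulen : ∀ k, k ≤ (u k).length := by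
      intro k
      induction k with
      | zero => exact Nat.zero_le _
      | succ k ih => exact Nat.succ_le_of_lt (ih.trans_lt (hnlen k.unpair.1 (u k) (huT k)))
    obtain ⟨p, hp⟩ := exists_sequence_of_prefixes (u := u)
      (fun k => hnpre k.unpair.1 (u k) (huT k)) (fun k => hnlen k.unpair.1 (u k) (huT k))
    have hstep : ∀ n l : ℕ, ∃ k : ℕ, l ≤ k ∧ k.unpair.1 = n := fun n l =>
      ⟨Nat.pair n l, Nat.right_le_pair n l, by simp⟩
    have hpu : ∀ l k, l ≤ k → prefixOf p l <+: u k := fun l k hlk => by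
      rw [← hp k]
      exact prefixOf_mono p (hlk.trans (hulen k))
    have hpdom : p ∈ δ.dom := by
      refine (hdom p).2 fun n hn => ?_
      obtain ⟨l, hl⟩ := (hR' n p p rfl).1 hn
      obtain ⟨k, hlk, rfl⟩ := hstep n l
      refine (hQ' _ p p rfl).2 ⟨(u (k + 1)).length, ?_⟩
      rw [hp (k + 1)]
      exact hnR _ _ (huT k) (hRmono _ _ _ (hpu l k hlk) hl)
    obtain ⟨x, hx⟩ := hpdom
    -- What `Φ` enumerates from the name `p` of `x` is the set of prefixes of names of `x`, so it
    -- remains to see that this is `T`.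
    refine ⟨x, Set.ext fun n => ?_⟩
    rw [← Denumerable.encode_ofNat (α := List ℕ) n, hΦ' p x hx]
    constructor
    · rintro ⟨l, hl⟩
      obtain ⟨-, -, h⟩ := hsub (u l, Denumerable.ofNat _ n) (hΦmono _ _ _ (hpu l l le_rfl) hl)
        (by simpa using huT l)
      exact h
    · intro hn
      rw [Denumerable.encode_ofNat] at hn
      obtain ⟨k, -, hk⟩ := hstep n 0
      refine ⟨(u (k + 1)).length, ?_⟩
      rw [hp (k + 1)]
      subst hk
      exact hnΦ _ (u k) (huT k) hn

end Range

end RepSpace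

theorem mainTheorem4 {X : Type u} (δX : RepSpace.Representation X) :
    [ ∃ r : ℕ → ℕ → Prop, REPred (fun a : ℕ × ℕ => r a.1 a.2) ∧ IsTrans ℕ r ∧
        RepSpace.ComputablyIsomorphic δX (RepSpace.RI r),
      ∃ S : Set (Set ℕ), RepSpace.IsPi02 RepSpace.openNat S ∧
        RepSpace.ComputablyIsomorphic δX (RepSpace.openNat.subspace S),
      ∃ δ : RepSpace.Representation X, RepSpace.ComputablyEquivalent δ δX ∧
        RepSpace.EffectivelyFiberOvert δ ∧ RepSpace.ComputablyAdmissible δ ∧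
        RepSpace.IsPi02 RepSpace.baire δ.dom ].TFAE := by
  tfae_have 1 → 2 := by
    rintro ⟨r, hr, -, h⟩
    exact ⟨_, RepSpace.isPi02_roundedIdeals hr, h⟩
  tfae_have 2 → 1 := by
    rintro ⟨S, hS, h⟩
    obtain ⟨r, hr, htrans, h'⟩ := RepSpace.exists_computablyIsomorphic_RI hS
    exact ⟨r, hr, htrans, h.trans h'⟩
  tfae_have 2 → 3 := by
    rintro ⟨S, hS, e, h, h'⟩
    exact ⟨RepSpace.pullback e, RepSpace.computablyEquivalent_pullback h h',
      RepSpace.effectivelyFiberOvert_pullback e, RepSpace.computablyAdmissible_pullback e,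
      RepSpace.isPi02_dom_pullback hS e⟩
  tfae_have 3 → 2 := by
    rintro ⟨δ, ⟨h1, h2⟩, hover, hadm, hdom⟩
    exact ⟨_, RepSpace.isPi02_range_namePrefixes hover hdom,
      RepSpace.ComputablyIsomorphic.trans ⟨Equiv.refl X, h2, h1⟩
        (RepSpace.computablyIsomorphic_range_namePrefixes hover hadm)⟩
  tfae_finish
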